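/- **Conventions.** A ranked alphabet is a set of symbols, each with a rank in $\{0,1,2,\dots\}$; $\Sigma^{(k)}$ is the set of symbols of rank $k$ in $\Sigma$, and for finite nonempty $\Sigma$, $\mathrm{mr}_\Sigma$ is the maximal rank of its symbols. $T_\Sigma$ is the set of trees over $\Sigma$. A *pattern of rank $k$* over $\Sigma$ is a tree over $\Sigma\cup\{x_1,\dots,x_k\}$ (variables have rank $0$) in which each of $x_1,\dots,x_k$ occurs exactly once. A forest is a finite sequence of trees. A *multiple context-free tree grammar* (MCFTG) $G=(N,\mathcal N,\Sigma,S,R)$ consists of a finite ranked alphabet $N$ of nonterminals; a finite set $\mathcal N$ of big nonterminals, which are nonempty repetition-free sequences over $N$, distinct ones having distinct sets of elements; a finite ranked alphabet $\Sigma$ of terminals, disjoint from $N$, with $\mathrm{mr}_\Sigma\ge 1$; an initial nonterminal $S\in N$ of rank $0$ with $(S)\in\mathcal N$; and a finite set $R$ of rules $A\to(u,\mathcal L)$, where $A=(A_1,\dots,A_n)\in\mathcal N$, $u=(u_1,\dots,u_n)$ with $u_j$ a pattern of rank $\mathrm{rk}(A_j)$ over $N\cup\Sigma$, no nonterminal occurs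 more than once in $u$, and $\mathcal L\subseteq\mathcal N$ is a set of big nonterminals (the links of the rule) whose sets of elements partition the set of nonterminals occurring in $u$. The multiplicity $\mu(G)$ is the maximal length of the big nonterminals, the width $\mathrm{wid}(G)$ is the maximal rank of the nonterminals, and $G$ is *monadic* if $\mathrm{wid}(G)\le 1$. $G$ is *start-separated* if $S$ does not occur in the right-hand side $u$ of any rule. For $\Delta\subseteq\Sigma$, $G$ is *$\Delta$-lexicalized* if for every rule $A\to(u,\mathcal L)$ for which $A\ne(S)$ or $\mathcal L\neq\emptyset$, some symbol of $\Delta$ occurs in $u$. Fix a linear order on the links of each rule. View $R$ as a ranked alphabet in which the rank of a rule is its number of links. The *derivation trees* of $G$ are the trees over $R$ generated from $(S)$ by the regular tree grammar with a rule $A\to\rho(B_1,\dots,B_k)$ for each $\rho=A\to(u,\{B_1,\dots,B_k\})$ in $R$. The value $\mathrm{val}(d)$ of $d=\rho(d_1,\dots,d_k)$ is the forest obtained from $u$ by (second-order) substituting, for all $i$ and $m$, the $m$-th tree of $\mathrm{val}(d_i)$ for the $m$-th nonterminal of $B_i$. An *LDT$^{\mathrm R}$-transducer* from $\Omega$ to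 $\Gamma$ (finite ranked alphabets) is a linear deterministic top-down tree transducer with regular look-ahead: it has finitely many states, an initial state $q_0$, and finitely many rules $\langle q,\omega(y_1{:}L_1,\dots,y_k{:}L_k){:}L_0\rangle\to\zeta$ with $\omega\in\Omega^{(k)}$, regular tree languages $L_0,\dots,L_k$ over $\Omega$, and $\zeta$ a tree over $\Gamma$ and rank-$0$ symbols $\langle q',y_i\rangle$, each $y_i$ occurring at most once in $\zeta$; for any two different rules with the same $q$ and $\omega$, the look-ahead languages at some index $0\le i\le k$ are disjoint. It realizes the partial function $M=M_{q_0}:T_\Omega\to T_\Gamma$, where $M_q(\omega(s_1,\dots,s_k))=\zeta[\langle q',y_i\rangle\leftarrow M_{q'}(s_i)]$ for the rule as above with $\omega(s_1,\dots,s_k)\in L_0$ and $s_i\in L_i$ for $1\le i\le k$ (undefined if there is no such rule, or if a required $M_{q'}(s_i)$ is undefined). MCFTGs $G$, $G'$ with the same terminal alphabet are *LDT$^{\mathrm R}$-equivalent* if there are LDT$^{\mathrm R}$-transducers $M$, $M'$ such that for every derivation tree $d$ of $G$, $M(d)$ is defined and is a derivation tree of $G'$ with $\mathrm{val}(M(d))=\mathrm{val}(d)$,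 and for every derivation tree $d'$ of $G'$, $M'(d')$ is defined and is a derivation tree of $G$ with $\mathrm{val}(M'(d'))=\mathrm{val}(d')$. **Theorem.** For every MCFTG $G$ with terminal alphabet $\Sigma$ and $\mathrm{wid}(G)\ge 2$ there is an LDT$^{\mathrm R}$-equivalent monadic start-separated MCFTG $G'$ such that $$\mu(G')\le \mu(G)\cdot|\Sigma|\cdot \mathrm{mr}_\Sigma^2\cdot(2\cdot\mathrm{wid}(G)-1).$$ Moreover, if $G$ is start-separated, then for every $\Delta\subseteq\Sigma^{(0)}$ such that $G$ is $\Delta$-lexicalized, $G'$ is $\Delta$-lexicalized. -/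

import Mathlib

universe u v w

/-! Trees over ranked alphabets -/

/-- A ranked alphabet: a type of symbols, each of which has a rank. -/
class RankedAlphabet (A : Type u) where
  /-- The rank of a symbol. -/
  rk : A → ℕ

open RankedAlphabet (rk)

/-- The (disjoint) union of two ranked alphabets. -/
instance RankedAlphabet.instSum {A : Type u} {B : Type v} [RankedAlphabet A] [RankedAlphabet B] :
    RankedAlphabet (A ⊕ B) :=
  ⟨Sum.elim rk rk⟩

/-- The maximal rank of the symbols of a finite ranked alphabet. -/
def maxRank (A : Type u) [Fintype A] [RankedAlphabet A] : ℕ :=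
  Finset.univ.sup (fun a : A => rk a)

/-- Trees over the ranked alphabet `A` in which, additionally, elements of `V` may label leaves
(as variables, i.e. symbols of rank 0).
* `RTree A Empty` is the set of trees over `A`;
* `RTree A ℕ` is the set of trees over `A` with variables `x₁, x₂, …`,
  where `leaf i` is the variable `xᵢ₊₁`. -/
inductive RTree (A : Type u) [RankedAlphabet A] (V : Type v) : Type (max u v)
  | leaf (x : V) : RTree A V
  | node (a : A) (ts : Fin (rk a) → RTree A V) : RTree A V

namespace RTree

variable {A : Type u} [RankedAlphabet A] {V : Type v} {W : Type w}

open scoped Classical in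
/-- The number of positions of a tree that are labeled by the symbol `a`. -/
noncomputable def countNode (a : A) : RTree A V → ℕ
  | leaf _ => 0
  | node b ts => (if b = a then 1 else 0) + ∑ i, countNode a (ts i)

open scoped Classical in
/-- The number of positions of a tree that are labeled by a variable with the property `p`. -/
noncomputable def countLeaf (p : V → Prop) : RTree A V → ℕ
  | leaf x => if p x then 1 else 0
  | node _ ts => ∑ i, countLeaf p (ts i)

/-- First-order substitution: every variable `x` is replaced by the tree `f x`. -/
def subst (f : V → RTree A W) : RTree A V → RTree A W
  | leaf x => f x
  | node a ts => node a (fun i => subst f (ts i))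

/-- The tree homomorphism determined by `h`. A node labeled `a`, of rank `k`, is replaced by the
tree `h a`, in which the images of its `k` subtrees are substituted for `x₁, …, xₖ`. (In all
uses no other variables occur in `h a`; they would be left unchanged.) -/
def hom {B : Type w} [RankedAlphabet B] (h : A → RTree B ℕ) : RTree A ℕ → RTree B ℕ
  | leaf x => leaf x
  | node a ts => (h a).subst (fun i => if hi : i < rk a then hom h (ts ⟨i, hi⟩) else leaf i)

/-- A pattern of rank `k`: each of the variables `x₁, …, xₖ` occurs exactly once, and no other
variable occurs. -/
def IsPattern (k : ℕ) (t : RTree A ℕ) : Prop :=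
  ∀ x : ℕ, t.countLeaf (fun y => y = x) = if x < k then 1 else 0

end RTree

/-! Regular tree grammars -/

/-- A regular tree grammar over `A` in normal form: `rule B a C` says that
`B → a(C₁, …, Cₖ)` is a rule, where `k` is the rank of `a`. -/
structure RTG (A : Type u) [RankedAlphabet A] where
  /-- The nonterminals. -/
  N : Type u
  finite_N : Finite N
  /-- The initial nonterminal. -/
  start : N
  /-- The rules. -/
  rule : N → (a : A) → (Fin (rk a) → N) → Prop

/-- `H.Generates B t`: the nonterminal `B` of `H` generates the tree `t`. -/
inductive RTG.Generates {A : Type u} [RankedAlphabet A] (H : RTG A) : H.N → RTree A Empty → Prop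
  | intro (B : H.N) (a : A) (C : Fin (rk a) → H.N) (ts : Fin (rk a) → RTree A Empty)
      (hrule : H.rule B a C) (hts : ∀ i, H.Generates (C i) (ts i)) :
      H.Generates B (RTree.node a ts)

/-- The tree language generated by a regular tree grammar. -/
def RTG.language {A : Type u} [RankedAlphabet A] (H : RTG A) : Set (RTree A Empty) :=
  {t | H.Generates H.start t}

/-- Regular tree languages. -/
def IsRegularTreeLanguage {A : Type u} [RankedAlphabet A] (L : Set (RTree A Empty)) : Prop :=
  ∃ H : RTG A, H.language = L

/-! Linear deterministic top-down tree transducers with regular look-ahead -/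

/-- The look-ahead languages and the right-hand side of a transducer rule
`⟨q, ω(y₁ : L₁, …, yₖ : Lₖ) : L₀⟩ → ζ`, for an input symbol `ω` of rank `k`. A leaf `(q', i)` of
the right-hand side stands for `⟨q', yᵢ⟩`. -/
structure LookaheadRule (Q : Type u) (A : Type u) [RankedAlphabet A] (B : Type u)
    [RankedAlphabet B] (k : ℕ) where
  /-- The look-ahead language `L₀` for the input tree itself. -/
  look₀ : Set (RTree A Empty)
  /-- The look-ahead languages `L₁, …, Lₖ` for the subtrees. -/
  look : Fin k → Set (RTree A Empty)
  /-- The right-hand side. -/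
  rhs : RTree B (Q × Fin k)

/-- A linear deterministic top-down tree transducer with regular look-ahead, with input alphabet
`A` and output alphabet `B`. -/
structure LDTR (A : Type u) [RankedAlphabet A] (B : Type u) [RankedAlphabet B] where
  /-- The states. -/
  Q : Type u
  finite_Q : Finite Q
  /-- The initial state. -/
  q₀ : Q
  /-- The rules with state `q` and input symbol `a` in the left-hand side. -/
  rules : Q → (a : A) → Set (LookaheadRule Q A B (rk a))
  finite_rules : ∀ q a, (rules q a).Finite
  regular_look₀ : ∀ q a, ∀ r ∈ rules q a, IsRegularTreeLanguage r.look₀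
  regular_look : ∀ q a, ∀ r ∈ rules q a, ∀ i, IsRegularTreeLanguage (r.look i)
  /-- Each input variable occurs at most once in each right-hand side. -/
  linear : ∀ q a, ∀ r ∈ rules q a, ∀ i, r.rhs.countLeaf (fun y => y.2 = i) ≤ 1
  /-- Different rules with the same state and input symbol have disjoint look-ahead at the input
  tree or at one of its direct subtrees. -/
  deterministic : ∀ q a, ∀ r ∈ rules q a, ∀ r' ∈ rules q a, r ≠ r' →
    Disjoint r.look₀ r'.look₀ ∨ ∃ i, Disjoint (r.look i) (r'.look i)

/-- `M.Translates q s t`: the `q`-translation of the input tree `s` by `M` is defined, and it is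
the tree `t`. -/
inductive LDTR.Translates {A : Type u} [RankedAlphabet A] {B : Type u} [RankedAlphabet B]
    (M : LDTR A B) : M.Q → RTree A Empty → RTree B Empty → Prop
  | intro (q : M.Q) (a : A) (ts : Fin (rk a) → RTree A Empty) (r : LookaheadRule M.Q A B (rk a))
      (hr : r ∈ M.rules q a) (h₀ : RTree.node a ts ∈ r.look₀) (h : ∀ i, ts i ∈ r.look i)
      (g : M.Q × Fin (rk a) → RTree B Empty)
      (hg : ∀ y, 0 < r.rhs.countLeaf (fun z => z = y) → M.Translates y.1 (ts y.2) (g y)) :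
      M.Translates q (RTree.node a ts) (r.rhs.subst g)

/-- `M.Realizes s t`: the translation `M(s)` is defined and equal to `t`. -/
def LDTR.Realizes {A : Type u} [RankedAlphabet A] {B : Type u} [RankedAlphabet B] (M : LDTR A B)
    (s : RTree A Empty) (t : RTree B Empty) : Prop :=
  M.Translates M.q₀ s t

/-! Multiple context-free tree grammars -/

/-- A rule `A → (u, 𝓛)` over the nonterminals `N` and the terminals `S`, not yet subject to any
requirement. -/
structure MRule (N : Type u) [RankedAlphabet N] (S : Type u) [RankedAlphabet S] where
  /-- The left-hand side `A`. -/
  lhs : List N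
  /-- The right-hand side `u`. -/
  rhs : List (RTree (N ⊕ S) ℕ)
  /-- The set `𝓛` of links. -/
  links : Finset (List N)

namespace MRule

variable {N : Type u} [RankedAlphabet N] {S : Type u} [RankedAlphabet S]

/-- The symbol `a` occurs in the right-hand side. -/
def Occurs (ρ : MRule N S) (a : N ⊕ S) : Prop :=
  ∃ t ∈ ρ.rhs, 0 < t.countNode a

/-- The requirements on a rule of a grammar with set `big` of big nonterminals. -/
structure WellFormed (big : Finset (List N)) (ρ : MRule N S) : Prop where
  lhs_mem : ρ.lhs ∈ big
  /-- The right-hand side is a forest of patterns of the same (multiple) rank as the left-hand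
  side. -/
  rank_eq : List.Forall₂ (fun (C : N) t => t.IsPattern (rk C)) ρ.lhs ρ.rhs
  /-- No nonterminal occurs more than once in the right-hand side. -/
  unique : ∀ C : N, (ρ.rhs.map (fun t => t.countNode (Sum.inl C))).sum ≤ 1
  links_subset : ρ.links ⊆ big
  /-- The links partition the set of nonterminals that occur in the right-hand side. -/
  occurs_of_mem_link : ∀ B ∈ ρ.links, ∀ C ∈ B, ρ.Occurs (Sum.inl C)
  existsUnique_link : ∀ C : N, ρ.Occurs (Sum.inl C) → ∃! B, B ∈ ρ.links ∧ C ∈ B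

/-- The `i`-th link of a rule, with respect to an arbitrary fixed linear order of its links. -/
noncomputable def link (ρ : MRule N S) (i : Fin ρ.links.card) : List N :=
  ρ.links.toList.get (i.cast ρ.links.length_toList.symm)

end MRule

/-- Multiple context-free tree grammars with terminal alphabet `S` (which is meant to be finite).
The use of a separate type of nonterminals makes them disjoint from the terminals. -/
structure MCFTG (S : Type u) [RankedAlphabet S] where
  /-- The nonterminals. -/
  N : Type u
  [fintypeN : Fintype N]
  [rankedN : RankedAlphabet N]
  /-- The big nonterminals. -/
  big : Finset (List N)
  big_ne_nil : ∀ A ∈ big, A ≠ []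
  big_nodup : ∀ A ∈ big, A.Nodup
  /-- Different big nonterminals have different sets of elements. -/
  big_inj : ∀ A ∈ big, ∀ B ∈ big, (∀ C, C ∈ A ↔ C ∈ B) → A = B
  /-- The initial nonterminal. -/
  start : N
  start_mem : [start] ∈ big
  rk_start : rk start = 0
  /-- The rules. -/
  rules : Finset (MRule N S)
  wellFormed : ∀ ρ ∈ rules, ρ.WellFormed big
  /-- The maximal rank of the terminals is at least 1. -/
  exists_rank_pos : ∃ σ : S, 1 ≤ rk σ

attribute [instance] MCFTG.fintypeN MCFTG.rankedN

namespace MCFTG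

variable {S : Type u} [RankedAlphabet S]

/-- The multiplicity (fan-out): the maximal length of the big nonterminals. -/
def multiplicity (G : MCFTG S) : ℕ := G.big.sup List.length

/-- The width: the maximal rank of the nonterminals. -/
def width (G : MCFTG S) : ℕ := maxRank G.N

/-- A grammar is monadic if its width is at most 1. -/
def IsMonadic (G : MCFTG S) : Prop := G.width ≤ 1

/-- The set of rules, viewed as the alphabet of the derivation trees. -/
abbrev R (G : MCFTG S) : Type u := {ρ : MRule G.N S // ρ ∈ G.rules}

/-- The rank of a rule is the number of its links. -/
instance instRankedR (G : MCFTG S) : RankedAlphabet G.R := ⟨fun ρ => ρ.1.links.card⟩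

/-- The derivation tree grammar: for each rule `ρ` with left-hand side `A` and links
`B₁, …, Bₖ` it has the rule `A → ρ(B₁, …, Bₖ)`. -/
def der (G : MCFTG S) : RTG G.R where
  N := {A : List G.N // A ∈ G.big}
  finite_N := inferInstance
  start := ⟨[G.start], G.start_mem⟩
  rule := fun A ρ B => ρ.1.lhs = A.1 ∧ ∀ i, (B i).1 = ρ.1.link i

open scoped Classical in
/-- The value of a derivation tree (with all leaves labeled by rules). If `d = ρ(d₁, …, dₖ)` and
`ρ = A → (u, {B₁, …, Bₖ})`, then it is obtained from `u` by second-order substitution, replacing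
the `m`-th nonterminal of `Bᵢ` by the `m`-th tree of the value of `dᵢ`. (For the trees generated
by the derivation tree grammar such a replacement exists for each nonterminal that occurs in
`u`.) -/
noncomputable def val (G : MCFTG S) : RTree G.R Empty → List (RTree S ℕ)
  | RTree.leaf e => e.elim
  | RTree.node ρ ts => ρ.1.rhs.map (RTree.hom (Sum.elim
      (fun C => if h : ∃ i : Fin (rk ρ), C ∈ ρ.1.link i then
          (val G (ts h.choose)).getD ((ρ.1.link h.choose).idxOf C) (RTree.leaf 0)
        else RTree.leaf 0)
      (fun σ => RTree.node σ (fun i => RTree.leaf i.1))))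

/-- The grammars are LDT^R-equivalent: there are transducers in both directions that translate the
derivation trees of one grammar into derivation trees of the other with the same value. -/
def LDTREquivalent (G G' : MCFTG S) : Prop :=
  (∃ M : LDTR G.R G'.R, ∀ d ∈ G.der.language,
    ∃ d', M.Realizes d d' ∧ d' ∈ G'.der.language ∧ G'.val d' = G.val d) ∧
  (∃ M' : LDTR G'.R G.R, ∀ d' ∈ G'.der.language,
    ∃ d, M'.Realizes d' d ∧ d ∈ G.der.language ∧ G.val d = G'.val d')

/-- The initial nonterminal does not occur in any right-hand side. -/
def IsStartSeparated (G : MCFTG S) : Prop :=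
  ∀ ρ ∈ G.rules, ¬ ρ.Occurs (Sum.inl G.start)

/-- A rule is proper if it is not both initial and terminal. -/
def IsProper (G : MCFTG S) (ρ : MRule G.N S) : Prop :=
  ¬ (ρ.lhs = [G.start] ∧ ρ.links = ∅)

/-- The grammar is `Δ`-lexicalized: the right-hand side of every proper rule contains a symbol
of `Δ`. -/
def IsLexicalized (G : MCFTG S) (Δ : Set S) : Prop :=
  ∀ ρ ∈ G.rules, G.IsProper ρ → ∃ δ ∈ Δ, ρ.Occurs (Sum.inr δ)

end MCFTG

/-! Consider a pattern over terminals and nonterminals of rank at most one. A node with variables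
below two of its subtrees must carry a terminal. These branching nodes form a skeleton; everything
above, between and beside them falls apart into patterns of rank at most one, which fill the holes
of the skeleton (`exists_plug_eq`). A skeleton with `k` variables has height at most `k` and at most
`1 + m * (k - 1)` holes, where `m` is the maximal terminal rank, so finitely many skeletons suffice.

A big nonterminal of `monadic`, apart from the new initial one, is a big nonterminal of `G`
annotated with skeletons, and its components are their holes. Given skeletons at the links of a
rule, they are substituted into its right-hand side and the resulting trees are decomposed: the
skeletons found annotate the left-hand side, the fillers form the new right-hand side (`innerRule`).
The annotation is thus computed bottom-up by a finite automaton, which regular look-ahead can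
consult; the inverse transducer merely forgets it. Values are preserved because filling a skeleton
commutes with second-order substitution (`hom_plug`, `valuesAgree_innerRule`).

The hole count bounds the multiplicity. A fresh initial nonterminal, whose rules keep the tree
undecomposed, gives start-separation. Branching symbols have rank at least two, so symbols of rank 0
are never absorbed into skeletons and lexicalization survives. -/

namespace RTree

/-! ### Occurrence counts under substitution and tree homomorphisms -/

section Counting

variable {A : Type u} [RankedAlphabet A] {B : Type w} [RankedAlphabet B] {V : Type v}

theorem countLeaf_child_eq_zero {p : V → Prop} {a : A} {ts : Fin (rk a) → RTree A V}
    (h : (node a ts).countLeaf p = 0) (i : Fin (rk a)) : (ts i).countLeaf p = 0 := by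
  rw [countLeaf] at h
  exact Finset.sum_eq_zero_iff.mp h i (Finset.mem_univ i)

theorem countNode_child_pos {a b : A} {ts : Fin (rk b) → RTree A V} (i : Fin (rk b))
    (h : 0 < (ts i).countNode a) : 0 < (node b ts).countNode a := by
  rw [countNode]
  have := Finset.single_le_sum (f := fun i => (ts i).countNode a) (fun _ _ => Nat.zero_le _)
    (Finset.mem_univ i)
  omega

theorem countNode_root_pos (a : A) (ts : Fin (rk a) → RTree A V) :
    0 < (node a ts).countNode a := by
  rw [countNode, if_pos rfl]
  omega

theorem subst_leaf (t : RTree A V) : t.subst leaf = t := by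
  induction t with
  | leaf x => rfl
  | node a ts ih => simp only [subst, ih]

theorem subst_subst {U W : Type*} (f : V → RTree A W) (g : W → RTree A U) (t : RTree A V) :
    (t.subst f).subst g = t.subst (fun x => (f x).subst g) := by
  induction t with
  | leaf x => rfl
  | node a ts ih => simp only [subst, ih]

theorem subst_congr {W : Type*} {f g : ℕ → RTree A W} {k : ℕ} {t : RTree A ℕ}
    (ht : ∀ x, k ≤ x → t.countLeaf (fun y => y = x) = 0) (h : ∀ x < k, f x = g x) :
    t.subst f = t.subst g := by
  induction t with
  | leaf x =>
    refine h x (not_le.mp fun hx => ?_)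
    simpa [countLeaf] using ht x hx
  | node a ts ih =>
    simp only [subst]
    congr 1
    funext i
    exact ih i fun x hx => countLeaf_child_eq_zero (ht x hx) i

/-- The weighted form is needed for the induction: subtrees of a pattern are in general not
patterns, but their variables still lie below `m`. -/
theorem countNode_subst {W : Type*} (a : A) (f : ℕ → RTree A W) (m : ℕ) (t : RTree A ℕ)
    (ht : ∀ x, m ≤ x → t.countLeaf (fun y => y = x) = 0) :
    (t.subst f).countNode a = t.countNode a +
      ∑ x ∈ Finset.range m, t.countLeaf (fun y => y = x) * (f x).countNode a := by
  induction t with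
  | leaf x =>
    have hx : x < m := not_le.mp fun hx => by simpa [countLeaf] using ht x hx
    simp [subst, countLeaf, countNode, hx]
  | node b ts ih =>
    simp only [subst, countNode, countLeaf]
    rw [Finset.sum_congr rfl fun i _ => ih i fun x hx => countLeaf_child_eq_zero (ht x hx) i,
      Finset.sum_add_distrib, Finset.sum_comm, add_assoc]
    simp only [Finset.sum_mul]

theorem countLeaf_subst {W : Type*} (p : W → Prop) (f : ℕ → RTree A W) (m : ℕ) (t : RTree A ℕ)
    (ht : ∀ x, m ≤ x → t.countLeaf (fun y => y = x) = 0) :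
    (t.subst f).countLeaf p =
      ∑ x ∈ Finset.range m, t.countLeaf (fun y => y = x) * (f x).countLeaf p := by
  induction t with
  | leaf x =>
    have hx : x < m := not_le.mp fun hx => by simpa [countLeaf] using ht x hx
    simp [subst, countLeaf, hx]
  | node b ts ih =>
    simp only [subst, countLeaf]
    rw [Finset.sum_congr rfl fun i _ => ih i fun x hx => countLeaf_child_eq_zero (ht x hx) i,
      Finset.sum_comm]
    simp only [Finset.sum_mul]

theorem IsPattern.countLeaf_eq_zero {k : ℕ} {t : RTree A ℕ} (h : t.IsPattern k) (x : ℕ)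
    (hx : k ≤ x) : t.countLeaf (fun y => y = x) = 0 := by
  rw [h x, if_neg (not_lt.mpr hx)]

theorem IsPattern.countNode_subst {W : Type*} {k : ℕ} {t : RTree A ℕ} (h : t.IsPattern k) (a : A)
    (f : ℕ → RTree A W) :
    (t.subst f).countNode a = t.countNode a + ∑ i : Fin k, (f i).countNode a := by
  rw [RTree.countNode_subst a f k t h.countLeaf_eq_zero, Finset.sum_range]
  congr 1
  refine Finset.sum_congr rfl fun i _ => ?_
  rw [h i, if_pos i.2, one_mul]

theorem IsPattern.countLeaf_subst {W : Type*} {k : ℕ} {t : RTree A ℕ} (h : t.IsPattern k)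
    (p : W → Prop) (f : ℕ → RTree A W) :
    (t.subst f).countLeaf p = ∑ i : Fin k, (f i).countLeaf p := by
  rw [RTree.countLeaf_subst p f k t h.countLeaf_eq_zero, Finset.sum_range]
  refine Finset.sum_congr rfl fun i _ => ?_
  rw [h i, if_pos i.2, one_mul]

/-- The tree consisting of one symbol applied to the variables. -/
def generic (a : A) : RTree A ℕ := node a fun i => leaf i.1

theorem generic_isPattern (a : A) : (generic a).IsPattern (rk a) := by
  intro x
  simp only [generic, countLeaf]
  split_ifs with hx
  · rw [Finset.sum_eq_single (⟨x, hx⟩ : Fin (rk a))]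
    · simp
    · intro b _ hb
      exact if_neg fun h => hb (Fin.ext h)
    · simp
  · exact Finset.sum_eq_zero fun i _ => if_neg fun h => hx ((show i.1 = x from h) ▸ i.2)

open scoped Classical in
theorem countNode_generic (a b : A) : (generic b).countNode a = if b = a then 1 else 0 := by
  simp [generic, countNode]

theorem generic_hom (h : A → RTree B ℕ) (a : A) : (generic a).hom h = h a := by
  simp only [generic, hom]
  conv_rhs => rw [← subst_leaf (h a)]
  congr 1
  funext i
  split_ifs <;> rfl

theorem countLeaf_hom (p : ℕ → Prop) (h : A → RTree B ℕ) (t : RTree A ℕ)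
    (ht : ∀ a, 0 < t.countNode a → (h a).IsPattern (rk a)) :
    (t.hom h).countLeaf p = t.countLeaf p := by
  induction t with
  | leaf x => rfl
  | node a ts ih =>
    simp only [hom, countLeaf]
    rw [(ht a (countNode_root_pos a ts)).countLeaf_subst]
    refine Finset.sum_congr rfl fun i _ => ?_
    rw [dif_pos i.2]
    exact ih i fun b hb => ht b (countNode_child_pos i hb)

theorem IsPattern.hom {k : ℕ} {t : RTree A ℕ} (hk : t.IsPattern k) (h : A → RTree B ℕ)
    (ht : ∀ a, 0 < t.countNode a → (h a).IsPattern (rk a)) : (t.hom h).IsPattern k := fun x => by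
  rw [countLeaf_hom _ h t ht, hk x]

theorem countNode_hom [Fintype A] (b : B) (h : A → RTree B ℕ) (t : RTree A ℕ)
    (ht : ∀ a, 0 < t.countNode a → (h a).IsPattern (rk a)) :
    (t.hom h).countNode b = ∑ a, t.countNode a * (h a).countNode b := by
  classical
  induction t with
  | leaf x => simp [RTree.hom, countNode]
  | node a ts ih =>
    simp only [RTree.hom, countNode]
    rw [(ht a (countNode_root_pos a ts)).countNode_subst]
    simp only [add_mul, Finset.sum_add_distrib, Finset.sum_mul, ite_mul, one_mul, zero_mul,
      Finset.sum_ite_eq, Finset.mem_univ, if_true]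
    rw [Finset.sum_comm]
    congr 1
    refine Finset.sum_congr rfl fun i _ => ?_
    rw [dif_pos i.2]
    exact ih i fun b hb => ht b (countNode_child_pos i hb)

theorem hom_congr {h g : A → RTree B ℕ} {t : RTree A ℕ}
    (ht : ∀ a, 0 < t.countNode a → h a = g a) : t.hom h = t.hom g := by
  induction t with
  | leaf x => rfl
  | node a ts ih =>
    simp only [hom]
    rw [ht a (countNode_root_pos a ts)]
    congr 1
    funext i
    split_ifs with hi
    · exact ih _ fun b hb => ht b (countNode_child_pos _ hb)
    · rfl

/-- The pattern condition excludes stray variables in `g a`: `hom` would leave them unchanged,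
whereas the outer substitution would replace them. -/
theorem hom_subst (g : A → RTree B ℕ) (f : ℕ → RTree A ℕ) (t : RTree A ℕ)
    (ht : ∀ a, 0 < t.countNode a → (g a).IsPattern (rk a)) :
    (t.subst f).hom g = (t.hom g).subst (fun x => (f x).hom g) := by
  induction t with
  | leaf x => rfl
  | node a ts ih =>
    simp only [subst, hom]
    rw [subst_subst]
    refine subst_congr (ht a (countNode_root_pos a ts)).countLeaf_eq_zero fun x hx => ?_
    rw [dif_pos hx, dif_pos hx]
    exact ih _ fun b hb => ht b (countNode_child_pos _ hb)

theorem hom_hom {C : Type*} [RankedAlphabet C] (h : A → RTree B ℕ) (g : B → RTree C ℕ)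
    (t : RTree A ℕ)
    (ht : ∀ a, 0 < t.countNode a → ∀ b, 0 < (h a).countNode b → (g b).IsPattern (rk b)) :
    (t.hom h).hom g = t.hom (fun a => (h a).hom g) := by
  induction t with
  | leaf x => rfl
  | node a ts ih =>
    simp only [hom]
    rw [hom_subst g _ _ (ht a (countNode_root_pos a ts))]
    congr 1
    funext i
    split_ifs with hi
    · exact ih _ fun b hb => ht b (countNode_child_pos _ hb)
    · rfl

end Counting

end RTree

namespace RTree

/-! ### Skeletons: size, finiteness, and filling of holes -/

section Skeletons

variable {S : Type u} [RankedAlphabet S] {B : Type w} [RankedAlphabet B]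

/-- The holes of a skeleton. In a skeleton, a leaf `none` stands for a tree without variables, a
leaf `some x` stands for a context applied to the variable `x`, and a node labeled `σ` stands for
a context applied to a tree with root symbol `σ`. -/
def Hole : RTree S (Option ℕ) → Type
  | leaf _ => Unit
  | node _ ts => Option (Σ i, Hole (ts i))

instance instFintypeHole : (s : RTree S (Option ℕ)) → Fintype s.Hole
  | leaf _ => inferInstanceAs (Fintype Unit)
  | node _ ts =>
    haveI : ∀ i, Fintype (Hole (ts i)) := fun i => instFintypeHole (ts i)
    inferInstanceAs (Fintype (Option (Σ i, Hole (ts i))))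

/-- The rank of a tree that may fill a hole. -/
def holeRank : (s : RTree S (Option ℕ)) → s.Hole → ℕ
  | leaf none => fun _ => 0
  | leaf (some _) => fun _ => 1
  | node _ ts => fun p => Option.elim p 1 fun q => holeRank (ts q.1) q.2

/-- The tree obtained by filling the holes of a skeleton, where `con` interprets its symbols. -/
def plug (con : (σ : S) → (Fin (rk σ) → RTree B ℕ) → RTree B ℕ) :
    (s : RTree S (Option ℕ)) → (s.Hole → RTree B ℕ) → RTree B ℕ
  | leaf none => fun g => g ()
  | leaf (some x) => fun g => (g ()).subst fun _ => leaf x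
  | node σ ts => fun g =>
    (g none).subst fun _ => con σ fun i => plug con (ts i) fun q => g (some ⟨i, q⟩)

theorem holeRank_le_one (s : RTree S (Option ℕ)) (p : s.Hole) : s.holeRank p ≤ 1 := by
  induction s with
  | leaf x => cases x <;> simp [holeRank]
  | node σ ts ih =>
    match p with
    | none => exact le_refl 1
    | some ⟨i, q⟩ => exact ih i q

theorem sum_hole_leaf (x : Option ℕ) (f : (leaf x : RTree S (Option ℕ)).Hole → ℕ) :
    ∑ p, f p = f () :=
  Fintype.sum_unique (ι := Unit) f

theorem sum_hole_node {σ : S} (ts : Fin (rk σ) → RTree S (Option ℕ))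
    (f : (node σ ts).Hole → ℕ) :
    ∑ p, f p = f none + ∑ i, ∑ q : (ts i).Hole, f (some ⟨i, q⟩) :=
  (Fintype.sum_option (α := Σ i, (ts i).Hole) f).trans
    (congrArg _ (Fintype.sum_sigma fun q : Σ i, (ts i).Hole => f (some q)))

theorem nonempty_hole : (s : RTree S (Option ℕ)) → Nonempty s.Hole
  | leaf _ => ⟨()⟩
  | node _ _ => ⟨none⟩

/-- Every node has at least two subtrees in which variables occur. -/
def IsBranching : RTree S (Option ℕ) → Prop
  | leaf _ => True
  | node _ ts => (∃ i j, i ≠ j ∧ 0 < (ts i).countLeaf (fun o => o ≠ none) ∧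
      0 < (ts j).countLeaf (fun o => o ≠ none)) ∧ ∀ i, IsBranching (ts i)

/-- This is what protects the symbols of `Δ`: a decomposition leaves all of them in the fillers. -/
theorem IsBranching.countNode_eq_zero {s : RTree S (Option ℕ)} (hs : s.IsBranching) {σ : S}
    (hσ : rk σ ≤ 1) : s.countNode σ = 0 := by
  induction s with
  | leaf x => rfl
  | node τ ts ih =>
    obtain ⟨⟨i, j, hij, -, -⟩, h⟩ := hs
    rw [countNode, if_neg, zero_add]
    · exact Finset.sum_eq_zero fun i _ => ih i (h i)
    · rintro rfl
      exact hij (Fin.ext (by omega))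

/-- The height of a tree. -/
def height {V : Type v} : RTree S V → ℕ
  | leaf _ => 0
  | node _ ts => 1 + Finset.univ.sup fun i => height (ts i)

/-- Every positive summand loses one, and at least two are positive. With `f` counting variables in
subtrees, this is the gain at a branching node that drives the height and hole bounds. -/
theorem sum_tsub_one_add_two_le {n : ℕ} (f : Fin n → ℕ) {i j : Fin n} (hij : i ≠ j)
    (hi : 0 < f i) (hj : 0 < f j) : ∑ k, (f k - 1) + 2 ≤ ∑ k, f k := by
  have h : ∑ k, (f k - 1) + ∑ k, (if k ∈ ({i, j} : Finset (Fin n)) then 1 else 0) ≤ ∑ k, f k := by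
    rw [← Finset.sum_add_distrib]
    refine Finset.sum_le_sum fun k _ => ?_
    split_ifs with hk
    · rcases Finset.mem_insert.mp hk with rfl | hk
      · omega
      · rw [Finset.mem_singleton.mp hk]
        omega
    · omega
  rwa [Finset.sum_ite_mem, Finset.univ_inter, Finset.sum_const, Finset.card_pair hij] at h

theorem IsBranching.height_le {s : RTree S (Option ℕ)} (hs : s.IsBranching) :
    s.height ≤ s.countLeaf (fun o => o ≠ none) := by
  induction s with
  | leaf x => exact Nat.zero_le _
  | node τ ts ih =>
    obtain ⟨⟨i, j, hij, hi, hj⟩, h⟩ := hs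
    have key := sum_tsub_one_add_two_le (fun k => (ts k).countLeaf (fun o => o ≠ none)) hij hi hj
    rw [height, countLeaf]
    have : (Finset.univ.sup fun i => height (ts i)) ≤
        ∑ k, ((ts k).countLeaf (fun o => o ≠ none) - 1) + 1 := by
      refine Finset.sup_le fun k _ => (ih k (h k)).trans ?_
      have := Finset.single_le_sum (f := fun k => (ts k).countLeaf (fun o => o ≠ none) - 1)
        (fun _ _ => Nat.zero_le _) (Finset.mem_univ k)
      omega
    omega

theorem card_hole_leaf (x : Option ℕ) : Fintype.card (leaf x : RTree S (Option ℕ)).Hole = 1 :=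
  Fintype.card_unit

theorem card_hole_node {σ : S} (ts : Fin (rk σ) → RTree S (Option ℕ)) :
    Fintype.card (node σ ts).Hole = 1 + ∑ i, Fintype.card (ts i).Hole := by
  simpa using sum_hole_node ts fun _ => 1

/-- A node adds one hole, and its at most `maxRank S` children contribute the constant term once
each. The two variables gained by branching pay for this; the truncated subtraction covers children
without variables, which have one hole. -/
theorem IsBranching.card_hole_le [Fintype S] {s : RTree S (Option ℕ)} (hs : s.IsBranching) :
    Fintype.card s.Hole ≤ 1 + maxRank S * (s.countLeaf (fun o => o ≠ none) - 1) := by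
  induction s with
  | leaf x => rw [card_hole_leaf]; omega
  | node τ ts ih =>
    obtain ⟨⟨i, j, hij, hi, hj⟩, h⟩ := hs
    have key := sum_tsub_one_add_two_le (fun k => (ts k).countLeaf (fun o => o ≠ none)) hij hi hj
    have hr : rk τ ≤ maxRank S := Finset.le_sup (f := fun a : S => rk a) (Finset.mem_univ τ)
    rw [card_hole_node, countLeaf]
    have h1 := Finset.sum_le_sum fun k (_ : k ∈ Finset.univ) => ih k (h k)
    rw [Finset.sum_add_distrib, ← Finset.mul_sum] at h1
    simp only [Finset.sum_const, Finset.card_univ, Fintype.card_fin, smul_eq_mul, mul_one] at h1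
    have h2 := Nat.mul_le_mul_left (maxRank S) (Nat.le_sub_of_add_le key)
    generalize ∑ k, (ts k).countLeaf (fun o => o ≠ none) = n at *
    generalize ∑ k, ((ts k).countLeaf (fun o => o ≠ none) - 1) = m at *
    have h3 : maxRank S * (n - 1) = maxRank S * (n - 2) + maxRank S := by
      rw [← Nat.mul_succ]
      congr 1
      omega
    omega

theorem countLeaf_ne_none (m : ℕ) (s : RTree S (Option ℕ))
    (hs : ∀ x, m ≤ x → s.countLeaf (fun o => o = some x) = 0) :
    s.countLeaf (fun o => o ≠ none) =
      ∑ x ∈ Finset.range m, s.countLeaf (fun o => o = some x) := by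
  induction s with
  | leaf o =>
    cases o with
    | none => simp [countLeaf]
    | some x =>
      have hx : x < m := not_le.mp fun hx => by simpa [countLeaf] using hs x hx
      simp [countLeaf, hx]
  | node b ts ih =>
    simp only [countLeaf]
    rw [Finset.sum_congr rfl fun i _ => ih i fun x hx => countLeaf_child_eq_zero (hs x hx) i,
      Finset.sum_comm]

/-- A skeleton for patterns of rank `k`. -/
structure IsSkeleton (k : ℕ) (s : RTree S (Option ℕ)) : Prop where
  branching : s.IsBranching
  pattern : ∀ x, s.countLeaf (fun o => o = some x) = if x < k then 1 else 0

theorem IsSkeleton.countLeaf_ne_none {k : ℕ} {s : RTree S (Option ℕ)} (hs : s.IsSkeleton k) :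
    s.countLeaf (fun o => o ≠ none) = k := by
  rw [RTree.countLeaf_ne_none k s fun x hx => by rw [hs.pattern, if_neg (not_lt.mpr hx)]]
  rw [Finset.sum_congr rfl fun x hx => by rw [hs.pattern, if_pos (Finset.mem_range.mp hx)]]
  simp

/-- The trees of height at most `n` all of whose leaves are in `L`. -/
def bounded {V : Type v} (L : Set V) : ℕ → Set (RTree S V)
  | 0 => leaf '' L
  | n + 1 => leaf '' L ∪ ⋃ σ : S, node σ '' Set.pi Set.univ fun _ => bounded L n

theorem finite_bounded [Finite S] {V : Type v} {L : Set V} (hL : L.Finite) (n : ℕ) :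
    (bounded (S := S) L n).Finite := by
  induction n with
  | zero => exact hL.image _
  | succ n ih =>
    exact (hL.image _).union (Set.finite_iUnion fun σ => (Set.Finite.pi' fun _ => ih).image _ |>.subset
      (Set.image_mono fun f hf i => hf i (Set.mem_univ i)))

theorem leaf_mem_bounded {V : Type v} {L : Set V} {x : V} (hx : x ∈ L) (n : ℕ) :
    (leaf x : RTree S V) ∈ bounded L n := by
  cases n with
  | zero => exact ⟨x, hx, rfl⟩
  | succ n => exact Or.inl ⟨x, hx, rfl⟩

theorem mem_bounded {V : Type v} {L : Set V} {n : ℕ} {t : RTree S V} (hn : t.height ≤ n)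
    (ht : ∀ x ∉ L, t.countLeaf (fun y => y = x) = 0) : t ∈ bounded L n := by
  induction t generalizing n with
  | leaf x =>
    exact leaf_mem_bounded (by_contra fun hx => by simpa [countLeaf] using ht x hx) n
  | node σ ts ih =>
    rw [height] at hn
    obtain ⟨n, rfl⟩ : ∃ m, n = m + 1 := ⟨n - 1, by omega⟩
    refine Or.inr (Set.mem_iUnion.mpr ⟨σ, ts, fun i _ => ih i ?_ fun x hx =>
      countLeaf_child_eq_zero (ht x hx) i, rfl⟩)
    have := Finset.le_sup (f := fun i => height (ts i)) (Finset.mem_univ i)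
    omega

/-- The trees of height at most `m` with leaves `none` and `some x` for `x < m`. -/
abbrev Shape (S : Type u) [RankedAlphabet S] (m : ℕ) : Type u :=
  {s : RTree S (Option ℕ) // s ∈ bounded (insert none (some '' Set.Iio m)) m}

instance [Finite S] (m : ℕ) : Finite (Shape S m) :=
  (finite_bounded (((Set.finite_Iio m).image _).insert none) m).to_subtype

instance (m : ℕ) : Inhabited (Shape S m) :=
  ⟨⟨leaf none, leaf_mem_bounded (Set.mem_insert _ _) m⟩⟩

/-- A single parameter bounds both the variables and the height, because branching keeps the height
below the number of variables. -/
theorem IsSkeleton.mem_bounded {k m : ℕ} {s : RTree S (Option ℕ)} (hs : s.IsSkeleton k)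
    (hk : k ≤ m) : s ∈ bounded (insert none (some '' Set.Iio m)) m := by
  refine RTree.mem_bounded
    ((hs.branching.height_le.trans hs.countLeaf_ne_none.le).trans hk) fun o ho => ?_
  cases o with
  | none => exact absurd (Set.mem_insert _ _) ho
  | some x =>
    rw [hs.pattern, if_neg]
    exact fun hx => ho (Or.inr ⟨x, lt_of_lt_of_le hx hk, rfl⟩)

section Plug

variable {con : (σ : S) → (Fin (rk σ) → RTree B ℕ) → RTree B ℕ}

theorem countLeaf_plug
    (hcon : ∀ σ ts x, (con σ ts).countLeaf (fun y => y = x) =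
      ∑ i, (ts i).countLeaf (fun y => y = x))
    (s : RTree S (Option ℕ)) (g : s.Hole → RTree B ℕ)
    (hg : ∀ p, (g p).IsPattern (s.holeRank p)) (x : ℕ) :
    (plug con s g).countLeaf (fun y => y = x) = s.countLeaf (fun o => o = some x) := by
  induction s with
  | leaf o =>
    cases o with
    | none => simpa [plug, countLeaf, holeRank] using hg () x
    | some z =>
      have h : (g ()).IsPattern 1 := hg ()
      simp [plug, h.countLeaf_subst, countLeaf]
  | node σ ts ih =>
    have h : (g none).IsPattern 1 := hg none
    simp only [plug, h.countLeaf_subst, countLeaf, Finset.univ_unique, Finset.sum_singleton, hcon]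
    exact Finset.sum_congr rfl fun i _ => ih i _ fun q => hg (some ⟨i, q⟩)

/-- Here `c σ` is the contribution of a skeleton node labeled `σ`. Requiring it to vanish on the
skeleton covers both uses: nonterminals, and terminals of rank at most one. -/
theorem countNode_plug_eq {b : B} (c : S → ℕ)
    (hcon : ∀ σ ts, (con σ ts).countNode b = c σ + ∑ i, (ts i).countNode b)
    (s : RTree S (Option ℕ)) (g : s.Hole → RTree B ℕ)
    (hg : ∀ p, (g p).IsPattern (s.holeRank p)) (hc : ∀ σ, 0 < s.countNode σ → c σ = 0) :
    (plug con s g).countNode b = ∑ p, (g p).countNode b := by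
  induction s with
  | leaf o =>
    rw [sum_hole_leaf]
    cases o with
    | none => rfl
    | some z =>
      have h : (g ()).IsPattern 1 := hg ()
      simp [plug, h.countNode_subst, countNode]
  | node σ ts ih =>
    have h : (g none).IsPattern 1 := hg none
    rw [sum_hole_node]
    simp only [plug, h.countNode_subst, Finset.univ_unique, Finset.sum_singleton, hcon,
      hc σ (countNode_root_pos σ ts), zero_add]
    congr 1
    exact Finset.sum_congr rfl fun i _ => ih i _ (fun q => hg (some ⟨i, q⟩))
      fun τ hτ => hc τ (countNode_child_pos i hτ)

/-- Evaluating a filled skeleton amounts to evaluating its fillers. Two interpretations of the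
skeleton symbols are needed, since evaluation passes from trees with nonterminals to terminal trees.
-/
theorem hom_plug {C : Type*} [RankedAlphabet C]
    {con' : (σ : S) → (Fin (rk σ) → RTree C ℕ) → RTree C ℕ} (h : B → RTree C ℕ)
    (hcon : ∀ σ ts, (con σ ts).hom h = con' σ fun i => (ts i).hom h)
    (s : RTree S (Option ℕ)) (g : s.Hole → RTree B ℕ)
    (hg : ∀ p b, 0 < (g p).countNode b → (h b).IsPattern (rk b)) :
    (plug con s g).hom h = plug con' s fun p => (g p).hom h := by
  induction s with
  | leaf o =>
    cases o with
    | none => rfl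
    | some z => exact hom_subst _ _ _ (hg ())
  | node σ ts ih =>
    simp only [plug]
    rw [hom_subst _ _ _ (hg none), hcon]
    congr 1
    funext _
    congr 1
    funext i
    exact ih i _ fun q => hg (some ⟨i, q⟩)

end Plug

end Skeletons

end RTree

namespace RTree

/-! ### Decomposition of trees over monadic nonterminals -/

section Decomposition

theorem countLeaf_mono {A : Type u} [RankedAlphabet A] {V : Type v} {p q : V → Prop}
    (h : ∀ x, p x → q x) (t : RTree A V) : t.countLeaf p ≤ t.countLeaf q := by
  induction t with
  | leaf x =>
    simp only [countLeaf]
    split_ifs with h1 h2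
    · exact le_refl 1
    · exact absurd (h x h1) h2
    · exact zero_le_one
    · exact le_refl 0
  | node a ts ih => exact Finset.sum_le_sum fun i _ => ih i

variable {A : Type u} [RankedAlphabet A]

theorem IsPattern.subst_of_zero {t : RTree A ℕ} (h : t.IsPattern 0) (f : ℕ → RTree A ℕ) :
    t.subst f = t := by
  conv_rhs => rw [← subst_leaf t]
  exact subst_congr h.countLeaf_eq_zero fun x hx => absurd hx (Nat.not_lt_zero x)

theorem isPattern_leaf : (leaf 0 : RTree A ℕ).IsPattern 1 := by
  intro x
  simp [countLeaf, eq_comm]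

theorem isPattern_node_zero {a : A} {ts : Fin (rk a) → RTree A ℕ}
    (h : ∀ i, (ts i).IsPattern 0) : (node a ts).IsPattern 0 := fun x => by
  rw [countLeaf, if_neg (Nat.not_lt_zero x)]
  exact Finset.sum_eq_zero fun i _ => (h i).countLeaf_eq_zero x (Nat.zero_le x)

open Function in
theorem isPattern_node_update {a : A} {ts : Fin (rk a) → RTree A ℕ} {i : Fin (rk a)}
    (h : ∀ j, j ≠ i → (ts j).IsPattern 0) {c : RTree A ℕ} (hc : c.IsPattern 1) :
    (node a (update ts i c)).IsPattern 1 := fun x => by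
  rw [countLeaf, Finset.sum_eq_single i, update_self, hc x]
  · intro j _ hj
    rw [update_of_ne hj]
    exact (h j hj).countLeaf_eq_zero x (Nat.zero_le x)
  · simp

open Function in
theorem subst_node_update {a : A} {ts : Fin (rk a) → RTree A ℕ} {i : Fin (rk a)}
    (h : ∀ j, j ≠ i → (ts j).IsPattern 0) (c : RTree A ℕ) (f : ℕ → RTree A ℕ) :
    (node a (update ts i c)).subst f = node a (update ts i (c.subst f)) := by
  rw [subst]
  congr 1
  funext j
  by_cases hj : j = i
  · subst hj
    rw [update_self, update_self]
  · rw [update_of_ne hj, update_of_ne hj, (h j hj).subst_of_zero]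

variable {N : Type u} [RankedAlphabet N] {S : Type v} [RankedAlphabet S]

/-- The construction of trees over `N ⊕ S` with a terminal root symbol. -/
def conInr (σ : S) (ts : Fin (rk σ) → RTree (N ⊕ S) ℕ) : RTree (N ⊕ S) ℕ :=
  node (Sum.inr σ : N ⊕ S) ts

theorem countLeaf_conInr (p : ℕ → Prop) (σ : S) (ts : Fin (rk σ) → RTree (N ⊕ S) ℕ) :
    (conInr σ ts).countLeaf p = ∑ i, (ts i).countLeaf p := rfl

theorem countNode_conInr (b : N ⊕ S) (σ : S) (ts : Fin (rk σ) → RTree (N ⊕ S) ℕ) :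
    (conInr σ ts).countNode b =
      (@ite _ ((Sum.inr σ : N ⊕ S) = b) (Classical.propDecidable _) 1 0) +
        ∑ i, (ts i).countNode b :=
  rfl

theorem countLeaf_plug_conInr {s : RTree S (Option ℕ)} {g : s.Hole → RTree (N ⊕ S) ℕ}
    (hg : ∀ p, (g p).IsPattern (s.holeRank p)) (x : ℕ) :
    (plug conInr s g).countLeaf (fun y => y = x) = s.countLeaf (fun o => o = some x) :=
  countLeaf_plug (fun _ _ _ => countLeaf_conInr _ _ _) s g hg x

theorem exists_plug_eq (hN : ∀ n : N, rk n ≤ 1) (t : RTree (N ⊕ S) ℕ) :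
    ∃ (s : RTree S (Option ℕ)) (g : s.Hole → RTree (N ⊕ S) ℕ),
      s.IsBranching ∧ (∀ p, (g p).IsPattern (s.holeRank p)) ∧ plug conInr s g = t := by
  induction t with
  | leaf x => exact ⟨leaf (some x), fun _ => leaf 0, trivial, fun _ => isPattern_leaf, rfl⟩
  | node a ts ih =>
    by_cases h0 : ∀ i, (ts i).IsPattern 0
    · exact ⟨leaf none, fun _ => node a ts, trivial, fun _ => isPattern_node_zero h0, rfl⟩
    obtain ⟨i, hi⟩ := not_forall.mp h0
    -- If only the `i`-th subtree has variables, the root is added on top of the uppermost context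
    -- in the decomposition of that subtree.
    by_cases h1 : ∀ j, j ≠ i → (ts j).IsPattern 0
    · obtain ⟨s, g, hs, hg, hsg⟩ := ih i
      cases s with
      | leaf o =>
        cases o with
        | none => exact absurd (show (ts i).IsPattern 0 from hsg ▸ hg ()) hi
        | some x =>
          refine ⟨leaf (some x), fun _ => node a (Function.update ts i (g ())), trivial,
            fun _ => isPattern_node_update h1 (hg ()), ?_⟩
          exact (subst_node_update h1 (g ()) _).trans
            ((congrArg (fun r => node a (Function.update ts i r)) hsg).trans
              (congrArg (node a) (Function.update_eq_self i ts)))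
      | node σ us =>
        refine ⟨node σ us, fun p => Option.elim p (node a (Function.update ts i (g none)))
          fun q => g (some q), hs, fun p => ?_, ?_⟩
        · cases p with
          | none => exact isPattern_node_update h1 (hg none)
          | some q => exact hg (some q)
        · exact (subst_node_update h1 (g none) _).trans
            ((congrArg (fun r => node a (Function.update ts i r)) hsg).trans
              (congrArg (node a) (Function.update_eq_self i ts)))
    -- With variables in two subtrees the root is a terminal and becomes a skeleton node; the hole
    -- above it receives the empty context `leaf 0`.
    · push Not at h1
      obtain ⟨j, hji, hj⟩ := h1
      cases a with
      | inl n =>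
        have h2 : rk n ≤ 1 := hN n
        have h3 : i.1 < rk n := i.2
        have h4 : j.1 < rk n := j.2
        exact absurd (Fin.ext (by omega)) hji
      | inr σ =>
        choose s g hs hg hsg using ih
        have key : ∀ k, ¬ (ts k).IsPattern 0 → 0 < (s k).countLeaf (fun o => o ≠ none) := by
          intro k hk
          refine Nat.pos_of_ne_zero fun h0 => hk fun x => ?_
          rw [if_neg (Nat.not_lt_zero x), ← hsg k, countLeaf_plug_conInr (hg k)]
          refine Nat.le_zero.mp (h0 ▸ countLeaf_mono (fun o ho => ?_) (s k))
          rw [ho]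
          exact Option.some_ne_none x
        refine ⟨node σ s, fun p => Option.elim p (leaf 0) fun q => g q.1 q.2,
          ⟨⟨i, j, hji.symm, key i hi, key j hj⟩, hs⟩, fun p => ?_, ?_⟩
        · cases p with
          | none => exact isPattern_leaf
          | some q => exact hg q.1 q.2
        · exact congrArg (node (Sum.inr σ : N ⊕ S)) (funext hsg)

/-- A decomposition of `t` with a skeleton for patterns of rank `k`. -/
structure IsDecomposition (k : ℕ) (t : RTree (N ⊕ S) ℕ) (s : RTree S (Option ℕ))
    (g : s.Hole → RTree (N ⊕ S) ℕ) : Prop where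
  isSkeleton : s.IsSkeleton k
  isPattern : ∀ p, (g p).IsPattern (s.holeRank p)
  plug_eq : plug conInr s g = t

/-- Skeleton and fillers are chosen before `k`, so they become functions of the tree alone; trees
that are not patterns of rank at most `m` receive a default. -/
theorem exists_isDecomposition (hN : ∀ n : N, rk n ≤ 1) (m : ℕ) (t : RTree (N ⊕ S) ℕ) :
    ∃ (s : Shape S m) (g : s.1.Hole → RTree (N ⊕ S) ℕ),
      ∀ k ≤ m, t.IsPattern k → IsDecomposition k t s.1 g := by
  by_cases h : ∃ k ≤ m, t.IsPattern k
  · obtain ⟨k, hk, ht⟩ := h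
    obtain ⟨s, g, hs, hg, hsg⟩ := exists_plug_eq hN t
    have key : ∀ l, t.IsPattern l → s.IsSkeleton l := fun l hl =>
      ⟨hs, fun x => by rw [← countLeaf_plug_conInr hg, hsg, hl x]⟩
    exact ⟨⟨s, (key k ht).mem_bounded hk⟩, g, fun l _ hl => ⟨key l hl, hg, hsg⟩⟩
  · exact ⟨default, fun _ => leaf 0, fun k hk ht => absurd ⟨k, hk, ht⟩ h⟩

theorem countNode_inl_plug (n : N) {s : RTree S (Option ℕ)} {g : s.Hole → RTree (N ⊕ S) ℕ}
    (hg : ∀ p, (g p).IsPattern (s.holeRank p)) :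
    (plug conInr s g).countNode (Sum.inl n) = ∑ p, (g p).countNode (Sum.inl n) :=
  countNode_plug_eq (fun _ => 0)
    (fun σ ts => by rw [countNode_conInr, if_neg Sum.inr_ne_inl]) s g hg fun _ _ => rfl

theorem countNode_inr_plug (σ : S) (hσ : rk σ ≤ 1) {s : RTree S (Option ℕ)}
    (hs : s.IsBranching) {g : s.Hole → RTree (N ⊕ S) ℕ}
    (hg : ∀ p, (g p).IsPattern (s.holeRank p)) :
    (plug conInr s g).countNode (Sum.inr σ) = ∑ p, (g p).countNode (Sum.inr σ) := by
  refine countNode_plug_eq _ (fun τ ts => countNode_conInr _ τ ts) s g hg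
    fun τ hτ => if_neg fun h => ?_
  rw [Sum.inr_injective h, hs.countNode_eq_zero hσ] at hτ
  exact lt_irrefl 0 hτ

end Decomposition

end RTree

/-! ### Bottom-up automata as look-ahead, and relabeling transducers -/

section Transducers

variable {A : Type u} [RankedAlphabet A] {B : Type u} [RankedAlphabet B]

/-- The state reached by a deterministic bottom-up tree automaton. -/
def RTree.eval {X : Type u} (f : (a : A) → (Fin (rk a) → X) → X) : RTree A Empty → X
  | leaf e => e.elim
  | node a ts => f a fun i => eval f (ts i)

/-- The automaton is read backwards as a grammar: each state generates exactly the trees that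
evaluate to it. -/
theorem isRegularTreeLanguage_eval {X : Type u} [Finite X]
    (f : (a : A) → (Fin (rk a) → X) → X) (x : X) :
    IsRegularTreeLanguage {t | RTree.eval f t = x} := by
  refine ⟨⟨X, inferInstance, x, fun y a C => f a C = y⟩, Set.ext fun t => ⟨fun h => ?_, fun h => ?_⟩⟩
  · change RTG.Generates _ _ t at h
    change RTree.eval f t = x
    suffices ∀ (H : RTG A) (hH : H = ⟨X, inferInstance, x, fun y a C => f a C = y⟩) (y : H.N),
        H.Generates y t → HEq (RTree.eval f t) y from eq_of_heq (this _ rfl _ h)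
    clear h
    intro H hH y hy
    induction hy with
    | intro y a C ts hrule hts ih =>
      subst hH
      have : (fun i => RTree.eval f (ts i)) = C := funext fun i => eq_of_heq (ih i)
      rw [RTree.eval, this]
      exact heq_of_eq hrule
  · have key : ∀ t : RTree A Empty, RTG.Generates
        (⟨X, inferInstance, x, fun y a C => f a C = y⟩ : RTG A) (RTree.eval f t) t := by
      intro t
      induction t with
      | leaf e => exact e.elim
      | node a ts ih => exact RTG.Generates.intro _ a _ ts rfl ih
    change RTree.eval f t = x at h
    change RTG.Generates _ _ t
    exact h ▸ key t

theorem isRegularTreeLanguage_univ : IsRegularTreeLanguage (Set.univ : Set (RTree A Empty)) := by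
  convert isRegularTreeLanguage_eval (A := A) (X := PUnit) (fun _ _ => PUnit.unit) PUnit.unit
  ext t
  simp

/-- A transducer that relabels each node, depending on its state and the states of a deterministic
bottom-up tree automaton at the direct subtrees. -/
def LDTR.relabeling {X : Type u} [Finite X] (f : (a : A) → (Fin (rk a) → X) → X) {Q : Type u}
    [Finite Q] (q₀ q₁ : Q)
    (out : Q → (a : A) → (Fin (rk a) → X) → Option (Σ b : B, Fin (rk b) ≃ Fin (rk a))) :
    LDTR A B where
  Q := Q
  finite_Q := inferInstance
  q₀ := q₀
  rules q a := {r | ∃ v, ∃ z ∈ out q a v, r =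
    ⟨Set.univ, fun i => {t | RTree.eval f t = v i},
      RTree.node z.1 fun i => RTree.leaf (q₁, z.2 i)⟩}
  finite_rules q a := by
    -- A rule is determined by the vector `v` of automaton states at the subtrees, and there are
    -- finitely many such vectors.
    refine (Set.finite_range fun v => (out q a v).map fun z =>
      (⟨Set.univ, fun i => {t | RTree.eval f t = v i},
        RTree.node z.1 fun i => RTree.leaf (q₁, z.2 i)⟩ :
        LookaheadRule Q A B (rk a))).preimage (Option.some_injective _).injOn |>.subset ?_
    rintro r ⟨v, z, hz, rfl⟩
    refine ⟨v, ?_⟩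
    simp only
    rw [hz]
    rfl
  regular_look₀ := by
    rintro q a r ⟨v, z, hz, rfl⟩
    exact isRegularTreeLanguage_univ
  regular_look := by
    rintro q a r ⟨v, z, hz, rfl⟩ i
    exact isRegularTreeLanguage_eval f (v i)
  linear := by
    rintro q a r ⟨v, z, hz, rfl⟩ i
    simp only [RTree.countLeaf]
    rw [Finset.sum_eq_single (z.2.symm i)]
    · split_ifs <;> omega
    · intro j _ hj
      exact if_neg fun h => hj (by simp [← h])
    · simp
  deterministic := by
    rintro q a r ⟨v, z, hz, rfl⟩ r' ⟨v', z', hz', rfl⟩ hne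
    right
    by_contra! h
    -- Evaluation is single-valued, so look-ahead languages that meet at every index belong to the
    -- same vector of states.
    have : v = v' := funext fun i => by
      obtain ⟨t, ht, ht'⟩ := Set.not_disjoint_iff.mp (h i)
      exact ht.symm.trans ht'
    subst this
    obtain rfl : z = z' := Option.mem_unique hz hz'
    exact hne rfl

theorem LDTR.relabeling_translates {X : Type u} [Finite X]
    {f : (a : A) → (Fin (rk a) → X) → X} {Q : Type u} [Finite Q] {q₀ q₁ : Q}
    {out : Q → (a : A) → (Fin (rk a) → X) → Option (Σ b : B, Fin (rk b) ≃ Fin (rk a))}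
    {q : Q} {a : A} {ts : Fin (rk a) → RTree A Empty} {b : B} {e : Fin (rk b) ≃ Fin (rk a)}
    (hout : out q a (fun i => RTree.eval f (ts i)) = some ⟨b, e⟩)
    {us : Fin (rk b) → RTree B Empty}
    (h : ∀ i, (LDTR.relabeling f q₀ q₁ out).Translates q₁ (ts (e i)) (us i)) :
    (LDTR.relabeling f q₀ q₁ out).Translates q (RTree.node a ts) (RTree.node b us) := by
  have := LDTR.Translates.intro (M := LDTR.relabeling f q₀ q₁ out) q a ts
    ⟨Set.univ, fun i => {t | RTree.eval f t = RTree.eval f (ts i)},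
      RTree.node b fun i => RTree.leaf (q₁, e i)⟩
    ⟨_, _, hout, rfl⟩ (Set.mem_univ _) (fun i => rfl) (fun y => us (e.symm y.2)) ?_
  · simpa [RTree.subst] using this
  · rintro ⟨q', i⟩ hy
    obtain ⟨i, rfl⟩ := e.surjective i
    have : q' = q₁ := by
      by_contra hne
      refine absurd hy (Nat.not_lt.mpr (Nat.le_zero.mpr ?_))
      exact Finset.sum_eq_zero fun j _ => if_neg fun h => hne (congrArg Prod.fst h).symm
    rw [this]
    exact (congrArg (fun j => (LDTR.relabeling f q₀ q₁ out).Translates q₁ (ts (e i)) (us j))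
      (e.symm_apply_apply i)).mpr (h i)

end Transducers

/-! ### Lookup in one list by position in another -/

section Lists

theorem List.Forall₂.getD_idxOf {α β : Type*} [DecidableEq α] {P : α → β → Prop} {l : List α}
    {ts : List β} (h : List.Forall₂ P l ts) {x : α} (hx : x ∈ l) (d : β) :
    P x (ts.getD (l.idxOf x) d) := by
  induction h with
  | nil => simp at hx
  | cons h1 _ ih =>
    rename_i y t l ts _
    by_cases hxy : y = x
    · subst hxy
      simpa using h1
    · rw [List.idxOf_cons_ne _ hxy, List.getD_cons_succ]
      exact ih ((List.mem_cons.mp hx).resolve_left (Ne.symm hxy))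

theorem List.sum_getD_idxOf {α β : Type*} [DecidableEq α] {l : List α} [Fintype {x // x ∈ l}] (hl : l.Nodup)
    {ts : List β} (h : l.length = ts.length) (d : β) (f : β → ℕ) :
    ∑ x : {x // x ∈ l}, f (ts.getD (l.idxOf x.1) d) = (ts.map f).sum := by
  rw [← Equiv.sum_comp (List.Nodup.getEquiv l hl)]
  have : ∀ i : Fin l.length, f (ts.getD (l.idxOf (List.Nodup.getEquiv l hl i).1) d) =
      f (ts.get (i.cast h)) := by
    intro i
    have hi : i.1 < ts.length := h ▸ i.2
    simp [hl.idxOf_getElem, hi]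
  rw [Finset.sum_congr rfl fun i _ => this i, ← Equiv.sum_comp (finCongr h.symm)]
  conv_rhs => rw [← List.ofFn_get ts, List.map_ofFn, List.sum_ofFn]
  rfl

end Lists

/-! ### Derivation trees and their values -/

section Grammars

theorem RTG.generates_node_iff {A : Type u} [RankedAlphabet A] {H : RTG A} {B : H.N} {a : A}
    {ts : Fin (rk a) → RTree A Empty} : H.Generates B (RTree.node a ts) ↔
      ∃ C, H.rule B a C ∧ ∀ i, H.Generates (C i) (ts i) := by
  refine ⟨fun h => ?_, fun ⟨C, hrule, hts⟩ => RTG.Generates.intro B a C ts hrule hts⟩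
  cases h with
  | intro _ _ C _ hrule hts => exact ⟨C, hrule, hts⟩

namespace MRule

variable {N : Type u} [RankedAlphabet N] {S : Type u} [RankedAlphabet S]

/-- The number of occurrences of a symbol in the right-hand side. -/
noncomputable def count (ρ : MRule N S) (a : N ⊕ S) : ℕ :=
  (ρ.rhs.map fun t => t.countNode a).sum

theorem occurs_iff (ρ : MRule N S) (a : N ⊕ S) : ρ.Occurs a ↔ 0 < ρ.count a := by
  rw [count, List.sum_pos_iff_exists_pos_nat]
  simp [Occurs]

theorem link_mem (ρ : MRule N S) (i : Fin ρ.links.card) : ρ.link i ∈ ρ.links :=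
  Finset.mem_toList.mp (List.get_mem _ _)

theorem link_injective (ρ : MRule N S) : Function.Injective ρ.link := fun i j h => by
  have := (Finset.nodup_toList ρ.links).injective_get h
  exact Fin.ext (by simpa [Fin.ext_iff] using this)

theorem exists_link_eq {ρ : MRule N S} {B : List N} (hB : B ∈ ρ.links) : ∃ i, ρ.link i = B := by
  obtain ⟨i, hi⟩ := List.get_of_mem (Finset.mem_toList.mpr hB)
  exact ⟨i.cast ρ.links.length_toList, hi⟩

end MRule

namespace MCFTG

variable {S : Type u} [RankedAlphabet S] (G : MCFTG S)

theorem link_mem_big (ρ : G.R) (i : Fin (rk ρ)) : ρ.1.link i ∈ G.big :=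
  (G.wellFormed ρ.1 ρ.2).links_subset (ρ.1.link_mem i)

/-- Links partition the occurring nonterminals. Hence the arbitrary choice of index in `val` is
harmless (`subVal_eq`). -/
theorem link_unique {ρ : G.R} {i j : Fin (rk ρ)} {C : G.N} (hi : C ∈ ρ.1.link i)
    (hj : C ∈ ρ.1.link j) : i = j := by
  have h := G.wellFormed ρ.1 ρ.2
  exact ρ.1.link_injective ((h.existsUnique_link C
    (h.occurs_of_mem_link _ (ρ.1.link_mem i) C hi)).unique ⟨ρ.1.link_mem i, hi⟩ ⟨ρ.1.link_mem j, hj⟩)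

theorem exists_mem_link {ρ : G.R} {C : G.N} (h : ρ.1.Occurs (Sum.inl C)) :
    ∃ i : Fin (rk ρ), C ∈ ρ.1.link i := by
  obtain ⟨B, ⟨hB, hC⟩, -⟩ := (G.wellFormed ρ.1 ρ.2).existsUnique_link C h
  obtain ⟨i, rfl⟩ := MRule.exists_link_eq hB
  exact ⟨i, hC⟩

open scoped Classical in
/-- The tree that is substituted for a nonterminal in the evaluation of a derivation tree. -/
noncomputable def subVal (ρ : G.R) (ts : Fin (rk ρ) → RTree G.R Empty) (C : G.N) : RTree S ℕ :=
  if h : ∃ i : Fin (rk ρ), C ∈ ρ.1.link i then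
    (G.val (ts h.choose)).getD ((ρ.1.link h.choose).idxOf C) (RTree.leaf 0)
  else RTree.leaf 0

theorem val_node (ρ : G.R) (ts : Fin (rk ρ) → RTree G.R Empty) :
    G.val (RTree.node ρ ts) =
      ρ.1.rhs.map (RTree.hom (Sum.elim (G.subVal ρ ts) RTree.generic)) := rfl

open scoped Classical in
theorem subVal_eq {ρ : G.R} (ts : Fin (rk ρ) → RTree G.R Empty) {C : G.N} {i : Fin (rk ρ)}
    (hi : C ∈ ρ.1.link i) :
    G.subVal ρ ts C = (G.val (ts i)).getD ((ρ.1.link i).idxOf C) (RTree.leaf 0) := by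
  have h : ∃ i : Fin (rk ρ), C ∈ ρ.1.link i := ⟨i, hi⟩
  rw [subVal, dif_pos h, G.link_unique h.choose_spec hi]

/-- The big nonterminal `A` generates the derivation tree `d`. -/
def Derives (A : List G.N) (d : RTree G.R Empty) : Prop :=
  ∃ hA : A ∈ G.big, G.der.Generates ⟨A, hA⟩ d

theorem mem_language_iff {d : RTree G.R Empty} :
    d ∈ G.der.language ↔ G.Derives [G.start] d :=
  ⟨fun h => ⟨_, h⟩, fun ⟨_, h⟩ => h⟩

variable {G}

theorem derives_node_iff {A : List G.N} {ρ : G.R} {ts : Fin (rk ρ) → RTree G.R Empty} :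
    G.Derives A (RTree.node ρ ts) ↔ ρ.1.lhs = A ∧ ∀ i, G.Derives (ρ.1.link i) (ts i) := by
  constructor
  · rintro ⟨hA, h⟩
    obtain ⟨C, hrule, hts⟩ := RTG.generates_node_iff.mp h
    refine ⟨hrule.1, fun i => ?_⟩
    rw [← hrule.2 i]
    exact ⟨(C i).2, hts i⟩
  · rintro ⟨rfl, h⟩
    exact ⟨(G.wellFormed ρ.1 ρ.2).lhs_mem,
      RTG.Generates.intro (H := G.der) _ ρ
        (fun i => (⟨ρ.1.link i, (h i).1⟩ : {A : List G.N // A ∈ G.big})) ts ⟨rfl, fun _ => rfl⟩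
        fun i => (h i).2⟩

theorem subVal_isPattern {ρ : G.R} {ts : Fin (rk ρ) → RTree G.R Empty}
    (h : ∀ i, List.Forall₂ (fun (C : G.N) t => t.IsPattern (rk C)) (ρ.1.link i) (G.val (ts i)))
    {t : RTree (G.N ⊕ S) ℕ} (ht : t ∈ ρ.1.rhs) (b : G.N ⊕ S) (hb : 0 < t.countNode b) :
    (Sum.elim (G.subVal ρ ts) RTree.generic b).IsPattern (rk b) := by
  classical
  cases b with
  | inl C =>
    obtain ⟨i, hi⟩ := G.exists_mem_link ⟨t, ht, hb⟩
    rw [Sum.elim_inl, G.subVal_eq ts hi]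
    exact (h i).getD_idxOf hi _
  | inr σ => exact RTree.generic_isPattern σ

theorem Derives.val_isPattern {A : List G.N} {d : RTree G.R Empty} (h : G.Derives A d) :
    List.Forall₂ (fun (C : G.N) t => t.IsPattern (rk C)) A (G.val d) := by
  induction d generalizing A with
  | leaf e => exact e.elim
  | node ρ ts ih =>
    obtain ⟨rfl, hts⟩ := derives_node_iff.mp h
    rw [val_node, List.forall₂_map_right_iff]
    refine List.forall₂_iff_zip.mpr ⟨?_, fun {C t} hCt => ?_⟩
    · exact (G.wellFormed ρ.1 ρ.2).rank_eq.length_eq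
    · have := (List.forall₂_iff_zip.mp (G.wellFormed ρ.1 ρ.2).rank_eq).2 hCt
      exact this.hom _ (subVal_isPattern (fun i => ih i (hts i)) (List.of_mem_zip hCt).2)

end MCFTG

end Grammars

/-! ### Annotated big nonterminals and annotated rules -/

namespace MCFTG

open RTree

variable {S : Type u} [RankedAlphabet S] (G : MCFTG S)

theorem rk_le_width (C : G.N) : rk C ≤ G.width :=
  Finset.le_sup (f := fun C : G.N => rk C) (Finset.mem_univ C)

/-- An assignment of skeletons to the nonterminals. -/
abbrev Shaping : Type u := G.N → Shape S G.width

/-- A big nonterminal together with skeletons for its elements. -/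
abbrev ShapedBig : Type u := {A : List G.N // A ∈ G.big} × G.Shaping

open scoped Classical in
noncomputable instance (x : G.ShapedBig) : Fintype {C // C ∈ x.1.1} := inferInstance

variable {G} in
/-- The holes of the skeletons of the elements of a big nonterminal. -/
abbrev ShapedBig.Holes (x : G.ShapedBig) : Type u := Σ C : {C // C ∈ x.1.1}, (x.2 C.1).1.Hole

/-- The nonterminals of the monadic grammar: a new initial nonterminal, and one nonterminal for
each hole. -/
inductive MonadicN : Type u
  | start : MonadicN
  | hole (x : G.ShapedBig) (l : x.Holes) : MonadicN

/-- Forget the constructor `start`. -/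
def MonadicN.toOption : G.MonadicN → Option (Σ x : G.ShapedBig, x.Holes)
  | start => none
  | hole x l => some ⟨x, l⟩

/-- The nonterminal of the given grammar to which a nonterminal belongs. -/
def MonadicN.base : G.MonadicN → Option G.N
  | start => none
  | hole _ l => some l.1.1

theorem MonadicN.toOption_injective :
    Function.Injective (MonadicN.toOption (G := G)) := by
  rintro (_ | _) (_ | _) h <;> cases h <;> rfl

instance [Finite S] : Finite G.MonadicN := Finite.of_injective _ (MonadicN.toOption_injective G)

noncomputable instance [Finite S] : Fintype G.MonadicN := Fintype.ofFinite _

instance : RankedAlphabet G.MonadicN where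
  rk
    | .start => 0
    | .hole x l => (x.2 l.1.1).1.holeRank l.2

theorem MonadicN.rk_le_one (n : G.MonadicN) : rk n ≤ 1 := by
  cases n with
  | start => exact zero_le_one
  | hole x l => exact holeRank_le_one _ _

/-- Trees over the terminals and the nonterminals of the monadic grammar. -/
abbrev MonadicTree : Type u := RTree (G.MonadicN ⊕ S) ℕ

variable {G}

/-- The big nonterminal of the monadic grammar that corresponds to a big nonterminal with
skeletons. -/
noncomputable def ShapedBig.names (x : G.ShapedBig) : List G.MonadicN :=
  (Finset.univ : Finset x.Holes).toList.map (MonadicN.hole x)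

theorem ShapedBig.hole_mem_names (x : G.ShapedBig) (l : x.Holes) :
    MonadicN.hole x l ∈ x.names :=
  List.mem_map_of_mem (Finset.mem_toList.mpr (Finset.mem_univ l))

theorem ShapedBig.eq_of_hole_mem {x y : G.ShapedBig} {l : x.Holes}
    (h : MonadicN.hole x l ∈ y.names) : y = x := by
  obtain ⟨l', -, h⟩ := List.mem_map.mp h
  exact (MonadicN.hole.inj h).1

theorem ShapedBig.exists_of_mem {x : G.ShapedBig} {n : G.MonadicN} (h : n ∈ x.names) :
    ∃ l, n = MonadicN.hole x l := by
  obtain ⟨l, -, h⟩ := List.mem_map.mp h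
  exact ⟨l, h.symm⟩

theorem ShapedBig.nonempty_holes (x : G.ShapedBig) : Nonempty x.Holes := by
  obtain ⟨C, hC⟩ := List.exists_mem_of_ne_nil _ (G.big_ne_nil x.1.1 x.1.2)
  obtain ⟨p⟩ := nonempty_hole (x.2 C).1
  exact ⟨⟨⟨C, hC⟩, p⟩⟩

theorem ShapedBig.names_ne_nil (x : G.ShapedBig) : x.names ≠ [] := by
  obtain ⟨l⟩ := x.nonempty_holes
  exact List.ne_nil_of_mem (x.hole_mem_names l)

theorem ShapedBig.names_nodup (x : G.ShapedBig) : x.names.Nodup :=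
  (Finset.nodup_toList _).map fun l l' h => by
    cases h
    rfl

/-- Each hole records its annotated big nonterminal, and there is at least one hole, so a single
common element already identifies the two. -/
theorem ShapedBig.names_injective : Function.Injective (ShapedBig.names (G := G)) :=
  fun x y h => by
    obtain ⟨l⟩ := x.nonempty_holes
    exact (ShapedBig.eq_of_hole_mem (h ▸ x.hole_mem_names l)).symm

/-- All skeletons fit the ranks of the nonterminals. -/
def ShapedBig.Proper (x : G.ShapedBig) : Prop := ∀ C ∈ x.1.1, (x.2 C).1.IsSkeleton (rk C)

theorem ShapedBig.Proper.length_names_le [Fintype S] {x : G.ShapedBig} (hx : x.Proper) :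
    x.names.length ≤ G.multiplicity * (1 + maxRank S * (G.width - 1)) := by
  have h : ∀ C : {C // C ∈ x.1.1}, Fintype.card (x.2 C.1).1.Hole ≤
      1 + maxRank S * (G.width - 1) := fun C => by
    refine (hx C.1 C.2).branching.card_hole_le.trans ?_
    rw [(hx C.1 C.2).countLeaf_ne_none]
    have := G.rk_le_width C.1
    gcongr
  have h2 : Fintype.card {C // C ∈ x.1.1} = x.1.1.length := by
    classical
    rw [← Fintype.card_fin x.1.1.length]
    exact Fintype.card_congr (List.Nodup.getEquiv _ (G.big_nodup _ x.1.2)).symm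
  have h3 : x.1.1.length ≤ G.multiplicity := Finset.le_sup (f := List.length) x.1.2
  rw [ShapedBig.names, List.length_map, Finset.length_toList, Finset.card_univ,
    Fintype.card_sigma]
  refine (Finset.sum_le_card_nsmul _ _ _ fun C _ => h C).trans ?_
  rw [Finset.card_univ, h2, smul_eq_mul]
  exact Nat.mul_le_mul_right _ h3

/-- The skeleton of an element of a big nonterminal, with the names of the holes. -/
def ShapedBig.tree (x : G.ShapedBig) (C : {C // C ∈ x.1.1}) : G.MonadicTree :=
  plug conInr (x.2 C.1).1 fun p => generic (Sum.inl (MonadicN.hole x ⟨C, p⟩))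

theorem ShapedBig.Proper.tree_isPattern {x : G.ShapedBig} (hx : x.Proper) (C : {C // C ∈ x.1.1}) :
    (x.tree C).IsPattern (rk C.1) := fun z => by
  rw [ShapedBig.tree, countLeaf_plug_conInr, (hx C.1 C.2).pattern]
  exact fun p => generic_isPattern _

theorem ShapedBig.countNode_tree (x : G.ShapedBig) (C : {C // C ∈ x.1.1}) (n : G.MonadicN) :
    (x.tree C).countNode (Sum.inl n) = ∑ p : (x.2 C.1).1.Hole,
      @ite _ (MonadicN.hole x ⟨C, p⟩ = n) (Classical.propDecidable _) 1 0 := by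
  rw [ShapedBig.tree, countNode_inl_plug n fun p => generic_isPattern _]
  refine Finset.sum_congr rfl fun p _ => ?_
  rw [countNode_generic]
  by_cases h : MonadicN.hole x ⟨C, p⟩ = n
  · rw [if_pos h, if_pos (congrArg Sum.inl h)]
  · rw [if_neg h, if_neg fun h' => h (Sum.inl_injective h')]

theorem ShapedBig.countNode_tree_le_one (x : G.ShapedBig) (C : {C // C ∈ x.1.1})
    (n : G.MonadicN) : (x.tree C).countNode (Sum.inl n) ≤ 1 := by
  classical
  rw [countNode_tree, Finset.sum_boole, Nat.cast_id, Finset.card_le_one]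
  intro p hp q hq
  have h := (Finset.mem_filter.mp hp).2.trans (Finset.mem_filter.mp hq).2.symm
  simpa using h

theorem ShapedBig.countNode_tree_pos_iff (x : G.ShapedBig) (C : {C // C ∈ x.1.1})
    (n : G.MonadicN) : 0 < (x.tree C).countNode (Sum.inl n) ↔ ∃ p, n = MonadicN.hole x ⟨C, p⟩ := by
  rw [countNode_tree, Nat.pos_iff_ne_zero, Ne, Finset.sum_eq_zero_iff]
  simp [eq_comm]

/-! Annotated rules -/

variable (ρ : G.R) (a : Fin (rk ρ) → G.Shaping)

/-- The links of a rule, with skeletons. -/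
noncomputable def shapedLink (i : Fin (rk ρ)) : G.ShapedBig :=
  (⟨ρ.1.link i, G.link_mem_big ρ i⟩, a i)

open scoped Classical in
/-- The tree that is substituted for a symbol in the right-hand side of a rule. -/
noncomputable def shapedSubst : G.N ⊕ S → G.MonadicTree :=
  Sum.elim (fun C => if h : ∃ i, C ∈ ρ.1.link i then
      (shapedLink ρ a h.choose).tree ⟨C, h.choose_spec⟩ else leaf 0)
    fun σ => generic (Sum.inr σ)

theorem shapedSubst_inl {C : G.N} {i : Fin (rk ρ)} (hi : C ∈ ρ.1.link i) :
    shapedSubst ρ a (Sum.inl C) = (shapedLink ρ a i).tree ⟨C, hi⟩ := by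
  have h : ∃ i : Fin (rk ρ), C ∈ ρ.1.link i := ⟨i, hi⟩
  have key : ∀ j (hj : C ∈ ρ.1.link j), j = i →
      (shapedLink ρ a j).tree ⟨C, hj⟩ = (shapedLink ρ a i).tree ⟨C, hi⟩ := by
    rintro j hj rfl
    rfl
  exact (dif_pos h).trans (key _ h.choose_spec (G.link_unique h.choose_spec hi))

/-- The right-hand side of the rule after the substitution of the skeletons. -/
noncomputable def body : List G.MonadicTree := ρ.1.rhs.map (hom (shapedSubst ρ a))

theorem exists_decomposition (t : G.MonadicTree) :
    ∃ (s : Shape S G.width) (g : s.1.Hole → G.MonadicTree),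
      ∀ k ≤ G.width, t.IsPattern k → IsDecomposition k t s.1 g :=
  exists_isDecomposition (MonadicN.rk_le_one G) G.width t

/-- The skeleton of a tree. -/
noncomputable def shapeOf (t : G.MonadicTree) : Shape S G.width := (exists_decomposition t).choose

/-- The trees that fill the holes of the skeleton of a tree. -/
noncomputable def fillers (t : G.MonadicTree) : (shapeOf t).1.Hole → G.MonadicTree :=
  (exists_decomposition t).choose_spec.choose

theorem isDecomposition_fillers {t : G.MonadicTree} {k : ℕ} (hk : k ≤ G.width)
    (ht : t.IsPattern k) : IsDecomposition k t (shapeOf t).1 (fillers t) :=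
  (exists_decomposition t).choose_spec.choose_spec k hk ht

open scoped Classical in
/-- The tree at a nonterminal of the left-hand side. -/
noncomputable def bodyAt (C : G.N) : G.MonadicTree := (body ρ a).getD (ρ.1.lhs.idxOf C) (leaf 0)

/-- The skeletons of the right-hand side. -/
noncomputable def shapingOf : G.Shaping := fun C => shapeOf (bodyAt ρ a C)

/-- The left-hand side with the skeletons of the right-hand side. -/
noncomputable def shapedLhs : G.ShapedBig :=
  (⟨ρ.1.lhs, (G.wellFormed ρ.1 ρ.2).lhs_mem⟩, shapingOf ρ a)

open scoped Classical in
/-- The links of the monadic rule. -/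
noncomputable def monadicLinks : Finset (List G.MonadicN) :=
  Finset.univ.image fun i => (shapedLink ρ a i).names

theorem mem_monadicLinks {B : List G.MonadicN} :
    B ∈ monadicLinks ρ a ↔ ∃ i, (shapedLink ρ a i).names = B := by
  simp [monadicLinks]

/-- The monadic rule that corresponds to an annotated rule. -/
noncomputable def innerRule : MRule G.MonadicN S where
  lhs := (shapedLhs ρ a).names
  rhs := (Finset.univ : Finset (shapedLhs ρ a).Holes).toList.map fun l =>
    fillers (bodyAt ρ a l.1.1) l.2
  links := monadicLinks ρ a

/-- The initial monadic rule that corresponds to an annotated initial rule. -/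
noncomputable def startRule : MRule G.MonadicN S where
  lhs := [MonadicN.start]
  rhs := body ρ a
  links := monadicLinks ρ a

/-- The skeletons at the links of a rule fit. -/
def IsValid : Prop := ∀ i, (shapedLink ρ a i).Proper

variable {ρ a}

theorem shapedSubst_isPattern (h : IsValid ρ a) {b : G.N ⊕ S} (hb : ρ.1.Occurs b) :
    (shapedSubst ρ a b).IsPattern (rk b) := by
  cases b with
  | inl C =>
    obtain ⟨i, hi⟩ := G.exists_mem_link hb
    rw [shapedSubst_inl ρ a hi]
    exact (h i).tree_isPattern ⟨C, hi⟩
  | inr σ => exact generic_isPattern (A := G.MonadicN ⊕ S) (Sum.inr σ)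

theorem body_isPattern (h : IsValid ρ a) :
    List.Forall₂ (fun (C : G.N) t => t.IsPattern (rk C)) ρ.1.lhs (body ρ a) := by
  rw [body, List.forall₂_map_right_iff]
  refine List.forall₂_iff_zip.mpr ⟨?_, fun {C t} hCt => ?_⟩
  · exact (G.wellFormed ρ.1 ρ.2).rank_eq.length_eq
  · have := (List.forall₂_iff_zip.mp (G.wellFormed ρ.1 ρ.2).rank_eq).2 hCt
    exact this.hom _ fun b hb => shapedSubst_isPattern h ⟨t, (List.of_mem_zip hCt).2, hb⟩

theorem bodyAt_isPattern (h : IsValid ρ a) {C : G.N} (hC : C ∈ ρ.1.lhs) :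
    (bodyAt ρ a C).IsPattern (rk C) := by
  classical
  exact (body_isPattern h).getD_idxOf hC (leaf 0)

theorem isDecomposition_bodyAt (h : IsValid ρ a) {C : G.N} (hC : C ∈ ρ.1.lhs) :
    IsDecomposition (rk C) (bodyAt ρ a C) (shapingOf ρ a C).1 (fillers (bodyAt ρ a C)) :=
  isDecomposition_fillers (G.rk_le_width C) (bodyAt_isPattern h hC)

/-- Validity propagates from the links to the left-hand side; this keeps the bottom-up annotation of
a derivation tree within the proper big nonterminals. -/
theorem shapedLhs_proper (h : IsValid ρ a) : (shapedLhs ρ a).Proper := fun _ hC =>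
  (isDecomposition_bodyAt h hC).isSkeleton

theorem sum_countNode_body [Fintype S] (h : IsValid ρ a) (b : G.MonadicN ⊕ S) :
    ((body ρ a).map fun t => t.countNode b).sum =
      ∑ c, ρ.1.count c * (shapedSubst ρ a c).countNode b := by
  rw [body, List.map_map]
  rw [List.map_congr_left (g := fun t => ∑ c, t.countNode c * (shapedSubst ρ a c).countNode b)]
  · simp only [MRule.count, ← List.sum_map_mul_right]
    generalize ρ.1.rhs = us
    induction us with
    | nil => simp
    | cons t us ih => simp only [List.map_cons, List.sum_cons, ih, Finset.sum_add_distrib]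
  · exact fun t ht => countNode_hom _ _ _ fun c hc => shapedSubst_isPattern h ⟨t, ht, hc⟩

theorem countNode_inl_shapedSubst_inr (n : G.MonadicN) (σ : S) :
    (shapedSubst ρ a (Sum.inr σ)).countNode (Sum.inl n) = 0 := by
  rw [shapedSubst, Sum.elim_inr, countNode_generic, if_neg Sum.inr_ne_inl]

theorem count_mul_countNode_pos_iff (n : G.MonadicN) (C : G.N) :
    0 < ρ.1.count (Sum.inl C) * (shapedSubst ρ a (Sum.inl C)).countNode (Sum.inl n) ↔
      ∃ i, ∃ hi : C ∈ ρ.1.link i, ∃ p, n = MonadicN.hole (shapedLink ρ a i) ⟨⟨C, hi⟩, p⟩ := by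
  constructor
  · intro h
    obtain ⟨i, hi⟩ := G.exists_mem_link ((ρ.1.occurs_iff _).mpr (Nat.pos_of_mul_pos_right h))
    refine ⟨i, hi, ?_⟩
    rw [← ShapedBig.countNode_tree_pos_iff, ← shapedSubst_inl]
    exact Nat.pos_of_mul_pos_left h
  · rintro ⟨i, hi, h⟩
    refine Nat.mul_pos ((ρ.1.occurs_iff _).mp
      ((G.wellFormed ρ.1 ρ.2).occurs_of_mem_link _ (ρ.1.link_mem i) C hi)) ?_
    rw [shapedSubst_inl ρ a hi, ShapedBig.countNode_tree_pos_iff]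
    exact h

theorem count_mul_countNode_le_one (n : G.MonadicN) (C : G.N) :
    ρ.1.count (Sum.inl C) * (shapedSubst ρ a (Sum.inl C)).countNode (Sum.inl n) ≤ 1 := by
  by_contra! h
  obtain ⟨i, hi, -⟩ := (count_mul_countNode_pos_iff n C).mp (zero_lt_one.trans h)
  have h1 : ρ.1.count (Sum.inl C) ≤ 1 := (G.wellFormed ρ.1 ρ.2).unique C
  have h2 : (shapedSubst ρ a (Sum.inl C)).countNode (Sum.inl n) ≤ 1 := by
    rw [shapedSubst_inl ρ a hi]
    exact ShapedBig.countNode_tree_le_one _ _ _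
  exact absurd h (not_lt.mpr (Nat.mul_le_mul h1 h2))

theorem sum_countNode_inl_body [Fintype S] (h : IsValid ρ a) (n : G.MonadicN) :
    ((body ρ a).map fun t => t.countNode (Sum.inl n)).sum =
      ∑ C, ρ.1.count (Sum.inl C) * (shapedSubst ρ a (Sum.inl C)).countNode (Sum.inl n) := by
  rw [sum_countNode_body h, Fintype.sum_sum_type]
  simp only [countNode_inl_shapedSubst_inr, mul_zero, Finset.sum_const_zero, add_zero]

/-- By `base`, a hole determines the nonterminal of `G` whose skeleton contains it. So at most one
summand is nonzero, and it is a product of two counts that are at most one. -/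
theorem sum_countNode_inl_body_le_one [Fintype S] (h : IsValid ρ a) (n : G.MonadicN) :
    ((body ρ a).map fun t => t.countNode (Sum.inl n)).sum ≤ 1 := by
  rw [sum_countNode_inl_body h]
  by_contra! hn
  obtain ⟨C, -, hC⟩ := Finset.exists_ne_zero_of_sum_ne_zero (zero_lt_one.trans hn).ne'
  refine absurd hn (not_lt.mpr ?_)
  rw [Finset.sum_eq_single C]
  · exact count_mul_countNode_le_one n C
  · intro D _ hDC
    by_contra hD
    obtain ⟨i, hi, p, hp⟩ := (count_mul_countNode_pos_iff n C).mp (Nat.pos_of_ne_zero hC)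
    obtain ⟨j, hj, q, hq⟩ := (count_mul_countNode_pos_iff n D).mp (Nat.pos_of_ne_zero hD)
    have := congrArg (MonadicN.base G) (hq.symm.trans hp)
    exact hDC (Option.some_injective _ this)
  · simp

theorem sum_countNode_inl_body_pos_iff [Fintype S] (h : IsValid ρ a) (n : G.MonadicN) :
    0 < ((body ρ a).map fun t => t.countNode (Sum.inl n)).sum ↔
      ∃ i, n ∈ (shapedLink ρ a i).names := by
  rw [sum_countNode_inl_body h, Finset.sum_pos_iff]
  constructor
  · rintro ⟨C, -, hC⟩
    obtain ⟨i, hi, p, rfl⟩ := (count_mul_countNode_pos_iff n C).mp hC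
    exact ⟨i, ShapedBig.hole_mem_names _ _⟩
  · rintro ⟨i, hi⟩
    obtain ⟨⟨⟨C, hC⟩, p⟩, rfl⟩ := ShapedBig.exists_of_mem hi
    exact ⟨C, Finset.mem_univ C, (count_mul_countNode_pos_iff _ C).mpr ⟨i, hC, p, rfl⟩⟩

/-- Only an inequality, since the skeletons at the links may bring in further terminals. -/
theorem le_sum_countNode_inr_body [Fintype S] (h : IsValid ρ a) (σ : S) :
    ρ.1.count (Sum.inr σ) ≤ ((body ρ a).map fun t => t.countNode (Sum.inr σ)).sum := by
  rw [sum_countNode_body h]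
  refine le_trans ?_ (Finset.single_le_sum (fun _ _ => Nat.zero_le _)
    (Finset.mem_univ (Sum.inr σ)))
  rw [shapedSubst, Sum.elim_inr, countNode_generic, if_pos rfl, mul_one]

/-- Symbols absent from the skeletons are neither lost nor duplicated when the body is cut into
fillers; the hypothesis states this for one tree at a time. -/
theorem count_innerRule (h : IsValid ρ a) {b : G.MonadicN ⊕ S}
    (hb : ∀ C ∈ ρ.1.lhs, (bodyAt ρ a C).countNode b =
      ∑ p, (fillers (bodyAt ρ a C) p).countNode b) :
    (innerRule ρ a).count b = ((body ρ a).map fun t => t.countNode b).sum := by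
  classical
  rw [MRule.count, innerRule, List.map_map]
  simp only [Finset.sum_map_toList]
  rw [Fintype.sum_sigma]
  rw [← List.sum_getD_idxOf (G.big_nodup _ (G.wellFormed ρ.1 ρ.2).lhs_mem)
    (body_isPattern h).length_eq (leaf 0)]
  refine Finset.sum_congr rfl fun C _ => ?_
  simp only [Function.comp]
  refine (hb C.1 C.2).symm.trans ?_
  rw [bodyAt]

theorem count_innerRule_inl (h : IsValid ρ a) (n : G.MonadicN) :
    (innerRule ρ a).count (Sum.inl n) =
      ((body ρ a).map fun t => t.countNode (Sum.inl n)).sum :=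
  count_innerRule h fun C hC => by
    have hd := isDecomposition_bodyAt h hC
    conv_lhs => rw [← hd.plug_eq]
    exact countNode_inl_plug n hd.isPattern

theorem count_innerRule_inr (h : IsValid ρ a) {σ : S} (hσ : rk σ ≤ 1) :
    (innerRule ρ a).count (Sum.inr σ) =
      ((body ρ a).map fun t => t.countNode (Sum.inr σ)).sum :=
  count_innerRule h fun C hC => by
    have hd := isDecomposition_bodyAt h hC
    conv_lhs => rw [← hd.plug_eq]
    exact countNode_inr_plug σ hσ hd.isSkeleton.branching hd.isPattern

end MCFTG

namespace MCFTG

open RTree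

variable {S : Type u} [RankedAlphabet S] {G : MCFTG S}

theorem ShapedBig.start_notMem_names (x : G.ShapedBig) : MonadicN.start ∉ x.names := fun h => by
  obtain ⟨l, hl⟩ := x.exists_of_mem h
  cases hl

/-- Both rules order their links arbitrarily, so corresponding derivation trees match only up to a
permutation of the children, which the transducers must perform. -/
theorem exists_linkEquiv {ρ : G.R} {a : Fin (rk ρ) → G.Shaping} {r : MRule G.MonadicN S}
    (hr : r.links = monadicLinks ρ a) :
    ∃ e : Fin r.links.card ≃ Fin (rk ρ), ∀ i, r.link i = (shapedLink ρ a (e i)).names := by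
  have h1 : ∀ i, ∃ j, (shapedLink ρ a j).names = r.link i := fun i =>
    (mem_monadicLinks ρ a).mp (hr ▸ r.link_mem i)
  choose f hf using h1
  refine ⟨Equiv.ofBijective f ⟨fun i j hij => r.link_injective ?_, fun j => ?_⟩, fun i => (hf i).symm⟩
  · rw [← hf i, ← hf j, hij]
  · obtain ⟨i, hi⟩ := MRule.exists_link_eq (hr ▸ (mem_monadicLinks ρ a).mpr ⟨j, rfl⟩ :
      (shapedLink ρ a j).names ∈ r.links)
    have := congrArg (fun x => x.1.1) (ShapedBig.names_injective ((hf i).trans hi))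
    exact ⟨i, ρ.1.link_injective this⟩

/-! ### The monadic grammar, its multiplicity and lexicalization -/

section Grammar

variable [Fintype S]

/-- The conditions on nonterminal occurrences depend only on total counts, which agree with those of
the undecomposed body for inner and initial rules alike. -/
theorem wellFormed_of_count_eq {ρ : G.R} {a : Fin (rk ρ) → G.Shaping} (h : IsValid ρ a)
    {r : MRule G.MonadicN S} {big : Finset (List G.MonadicN)}
    (hbig : ∀ i, (shapedLink ρ a i).names ∈ big) (hlinks : r.links = monadicLinks ρ a)
    (hlhs : r.lhs ∈ big)
    (hrank : List.Forall₂ (fun (n : G.MonadicN) t => t.IsPattern (rk n)) r.lhs r.rhs)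
    (hcount : ∀ n, r.count (Sum.inl n) =
      ((body ρ a).map fun t => t.countNode (Sum.inl n)).sum) : r.WellFormed big where
  lhs_mem := hlhs
  rank_eq := hrank
  unique n := (hcount n).trans_le (sum_countNode_inl_body_le_one h n)
  links_subset B hB := by
    obtain ⟨i, rfl⟩ := (mem_monadicLinks ρ a).mp (hlinks ▸ hB)
    exact hbig i
  occurs_of_mem_link B hB n hn := by
    obtain ⟨i, rfl⟩ := (mem_monadicLinks ρ a).mp (hlinks ▸ hB)
    rw [r.occurs_iff, hcount, sum_countNode_inl_body_pos_iff h]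
    exact ⟨i, hn⟩
  existsUnique_link n hn := by
    rw [r.occurs_iff, hcount, sum_countNode_inl_body_pos_iff h] at hn
    obtain ⟨i, hi⟩ := hn
    refine ⟨_, ⟨hlinks ▸ (mem_monadicLinks ρ a).mpr ⟨i, rfl⟩, hi⟩, ?_⟩
    rintro B ⟨hB, hn⟩
    obtain ⟨j, rfl⟩ := (mem_monadicLinks ρ a).mp (hlinks ▸ hB)
    obtain ⟨l, rfl⟩ := ShapedBig.exists_of_mem hi
    rw [ShapedBig.eq_of_hole_mem hn]

/-- The rule `r` is the monadic version of the annotated rule. -/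
def IsInner (ρ : G.R) (a : Fin (rk ρ) → G.Shaping) (r : MRule G.MonadicN S) : Prop :=
  IsValid ρ a ∧ (∃ τ ∈ G.rules, ρ.1.lhs ∈ τ.links) ∧ r = innerRule ρ a

/-- The rule `r` is the monadic initial version of the annotated initial rule. -/
def IsInitial (ρ : G.R) (a : Fin (rk ρ) → G.Shaping) (r : MRule G.MonadicN S) : Prop :=
  IsValid ρ a ∧ ρ.1.lhs = [G.start] ∧ r = startRule ρ a

theorem wellFormed_innerRule {ρ : G.R} {a : Fin (rk ρ) → G.Shaping} (h : IsValid ρ a)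
    {big : Finset (List G.MonadicN)} (hbig : ∀ x : G.ShapedBig, x.Proper → x.names ∈ big) :
    (innerRule ρ a).WellFormed big := by
  refine wellFormed_of_count_eq h (fun i => hbig _ (h i)) rfl (hbig _ (shapedLhs_proper h)) ?_
    (count_innerRule_inl h)
  simp only [innerRule, ShapedBig.names]
  rw [List.forall₂_map_left_iff, List.forall₂_map_right_iff, List.forall₂_same]
  exact fun l _ => (isDecomposition_bodyAt h l.1.2).isPattern l.2

theorem wellFormed_startRule {ρ : G.R} {a : Fin (rk ρ) → G.Shaping} (h : IsValid ρ a)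
    (hρ : ρ.1.lhs = [G.start])
    {big : Finset (List G.MonadicN)} (hbig : ∀ x : G.ShapedBig, x.Proper → x.names ∈ big)
    (hstart : [MonadicN.start] ∈ big) :
    (startRule ρ a).WellFormed big := by
  refine wellFormed_of_count_eq h (fun i => hbig _ (h i)) rfl hstart ?_ fun n => rfl
  have h1 := body_isPattern h
  rw [hρ] at h1
  obtain ⟨t, l, h2, h3, h4⟩ := List.forall₂_cons_left_iff.mp h1
  simp only [startRule]
  rw [h4, List.forall₂_nil_left_iff.mp h3]
  rw [G.rk_start] at h2
  exact List.Forall₂.cons h2 List.Forall₂.nil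

variable (G) in
theorem finite_monadicRules : {r | ∃ (ρ : G.R) (a : Fin (rk ρ) → G.Shaping),
    IsInner ρ a r ∨ IsInitial ρ a r}.Finite := by
  refine ((Set.finite_range fun z : Σ ρ : G.R, Fin (rk ρ) → G.Shaping =>
    innerRule z.1 z.2).union (Set.finite_range fun z : Σ ρ : G.R, Fin (rk ρ) → G.Shaping =>
      startRule z.1 z.2)).subset ?_
  rintro r ⟨ρ, a, h | h⟩
  · exact Or.inl ⟨⟨ρ, a⟩, h.2.2.symm⟩
  · exact Or.inr ⟨⟨ρ, a⟩, h.2.2.symm⟩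

variable (G) in
/-- The monadic grammar. -/
noncomputable def monadic : MCFTG S where
  N := G.MonadicN
  big := (Set.toFinite (insert [MonadicN.start]
    (ShapedBig.names '' {x : G.ShapedBig | x.Proper}))).toFinset
  big_ne_nil A hA := by
    rcases (Set.Finite.mem_toFinset _).mp hA with rfl | ⟨x, -, rfl⟩
    · exact List.cons_ne_nil _ _
    · exact x.names_ne_nil
  big_nodup A hA := by
    rcases (Set.Finite.mem_toFinset _).mp hA with rfl | ⟨x, -, rfl⟩
    · exact List.nodup_singleton _
    · exact x.names_nodup
  big_inj A hA B hB h := by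
    rcases (Set.Finite.mem_toFinset _).mp hA with rfl | ⟨x, -, rfl⟩ <;>
    rcases (Set.Finite.mem_toFinset _).mp hB with rfl | ⟨y, -, rfl⟩
    · rfl
    · exact absurd ((h _).mp (List.mem_singleton.mpr rfl)) y.start_notMem_names
    · exact absurd ((h _).mpr (List.mem_singleton.mpr rfl)) x.start_notMem_names
    · obtain ⟨l⟩ := x.nonempty_holes
      rw [ShapedBig.eq_of_hole_mem ((h _).mp (x.hole_mem_names l))]
  start := MonadicN.start
  start_mem := (Set.Finite.mem_toFinset _).mpr (Set.mem_insert _ _)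
  rk_start := rfl
  rules := (finite_monadicRules G).toFinset
  wellFormed r hr := by
    obtain ⟨ρ, a, ⟨h1, -, rfl⟩ | ⟨h1, h2, rfl⟩⟩ := (Set.Finite.mem_toFinset _).mp hr
    · exact wellFormed_innerRule h1 fun x hx => (Set.Finite.mem_toFinset _).mpr
        (Set.mem_insert_of_mem _ ⟨x, hx, rfl⟩)
    · exact wellFormed_startRule h1 h2 (fun x hx => (Set.Finite.mem_toFinset _).mpr
        (Set.mem_insert_of_mem _ ⟨x, hx, rfl⟩)) ((Set.Finite.mem_toFinset _).mpr
          (Set.mem_insert _ _))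
  exists_rank_pos := G.exists_rank_pos

theorem mem_monadic_big {A : List G.MonadicN} :
    A ∈ G.monadic.big ↔ A = [MonadicN.start] ∨ ∃ x : G.ShapedBig, x.Proper ∧ x.names = A :=
  Set.Finite.mem_toFinset _

theorem mem_monadic_rules {r : MRule G.MonadicN S} :
    r ∈ G.monadic.rules ↔
      ∃ (ρ : G.R) (a : Fin (rk ρ) → G.Shaping), IsInner ρ a r ∨ IsInitial ρ a r :=
  Set.Finite.mem_toFinset _

theorem monadic_isMonadic : G.monadic.IsMonadic :=
  Finset.sup_le fun n _ => MonadicN.rk_le_one G n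

theorem monadic_isStartSeparated : G.monadic.IsStartSeparated := by
  intro r hr hs
  obtain ⟨ρ, a, h⟩ := mem_monadic_rules.mp hr
  have : ∃ i, MonadicN.start ∈ (shapedLink ρ a i).names := by
    rcases h with ⟨h1, -, rfl⟩ | ⟨h1, -, rfl⟩
    · rw [← sum_countNode_inl_body_pos_iff h1, ← count_innerRule_inl h1]
      exact (MRule.occurs_iff _ _).mp hs
    · rw [← sum_countNode_inl_body_pos_iff h1]
      exact (MRule.occurs_iff _ _).mp hs
  obtain ⟨i, hi⟩ := this
  exact ShapedBig.start_notMem_names _ hi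

theorem monadic_multiplicity_le (hG : 2 ≤ G.width) : G.monadic.multiplicity ≤
    G.multiplicity * Fintype.card S * maxRank S ^ 2 * (2 * G.width - 1) := by
  have hμ : 1 ≤ G.multiplicity := Finset.le_sup (f := List.length) G.start_mem
  obtain ⟨σ, hσ⟩ := G.exists_rank_pos
  have hm : 1 ≤ maxRank S := hσ.trans (Finset.le_sup (f := fun a : S => rk a) (Finset.mem_univ σ))
  have hS : 1 ≤ Fintype.card S := Fintype.card_pos_iff.mpr ⟨σ⟩
  have key : G.multiplicity * (1 + maxRank S * (G.width - 1)) ≤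
      G.multiplicity * Fintype.card S * maxRank S ^ 2 * (2 * G.width - 1) := by
    rw [mul_assoc, mul_assoc]
    refine Nat.mul_le_mul_left _ ?_
    -- The construction even achieves `maxRank S * G.width` per component of a big nonterminal; the
    -- remaining factors are slack.
    calc 1 + maxRank S * (G.width - 1) ≤ maxRank S + maxRank S * (G.width - 1) := by omega
      _ = 1 * (maxRank S * (1 * (1 + (G.width - 1)))) := by ring
      _ ≤ Fintype.card S * (maxRank S * (maxRank S * (2 * G.width - 1))) := by
        gcongr
        omega
      _ = Fintype.card S * (maxRank S ^ 2 * (2 * G.width - 1)) := by ring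
  refine Finset.sup_le fun A hA => ?_
  rcases mem_monadic_big.mp hA with rfl | ⟨x, hx, rfl⟩
  · refine le_trans ?_ key
    exact Nat.mul_le_mul hμ (Nat.le_add_right 1 _)
  · exact hx.length_names_le.trans key

theorem monadic_isLexicalized (hG : G.IsStartSeparated) {Δ : Set S} (hΔ : ∀ δ ∈ Δ, rk δ = 0)
    (h : G.IsLexicalized Δ) : G.monadic.IsLexicalized Δ := by
  intro r hr hproper
  obtain ⟨ρ, a, hra⟩ := mem_monadic_rules.mp hr
  -- An exempt rule of `G`, initial and without links, yields no inner rule: its left-hand side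
  -- would be a link, contradicting start-separation. The initial rule it yields is exempt again.
  have hρ : G.IsProper ρ.1 := by
    rintro ⟨h1, h2⟩
    rcases hra with ⟨-, ⟨τ, hτ, h3⟩, -⟩ | ⟨-, -, rfl⟩
    · exact hG τ hτ ((G.wellFormed τ hτ).occurs_of_mem_link _ h3 _ (h1 ▸ List.mem_singleton.mpr rfl))
    · refine hproper ⟨rfl, Finset.eq_empty_of_forall_notMem fun B hB => ?_⟩
      obtain ⟨i, -⟩ := (mem_monadicLinks ρ a).mp hB
      have := ρ.1.link_mem i
      rw [h2] at this
      exact absurd this (Finset.notMem_empty _)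
  obtain ⟨δ, hδ, hocc⟩ := h ρ.1 ρ.2 hρ
  refine ⟨δ, hδ, (MRule.occurs_iff _ _).mpr ?_⟩
  have hpos := (ρ.1.occurs_iff _).mp hocc
  rcases hra with ⟨h1, -, rfl⟩ | ⟨h1, -, rfl⟩
  · have := count_innerRule_inr h1 (σ := δ) (by rw [hΔ δ hδ]; exact zero_le_one)
    exact (hpos.trans_le (le_sum_countNode_inr_body h1 δ)).trans_eq this.symm
  · exact hpos.trans_le (le_sum_countNode_inr_body h1 δ)

end Grammar

/-! ### Preservation of values -/

section Values

theorem generic_hom_inr {N : Type u} [RankedAlphabet N] (h : N → RTree S ℕ) (σ : S)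
    (vs : Fin (rk σ) → RTree (N ⊕ S) ℕ) :
    (conInr σ vs).hom (Sum.elim h generic) =
      node σ fun i => (vs i).hom (Sum.elim h generic) := by
  refine congrArg (node σ) (funext fun i => ?_)
  exact dif_pos (c := i.1 < rk (Sum.inr σ : N ⊕ S)) i.2

variable [Fintype S]

open scoped Classical in
/-- The value of `d` at the elements of the big nonterminal is obtained by filling the holes with
the value of `d'`. -/
def ValuesAgree (x : G.ShapedBig) (d : RTree G.R Empty) (d' : RTree G.monadic.R Empty) : Prop :=
  ∀ C : {C // C ∈ x.1.1}, (G.val d).getD (x.1.1.idxOf C.1) (leaf 0) =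
    plug (fun σ ts => node σ ts) (x.2 C.1).1 fun p =>
      (G.monadic.val d').getD (List.idxOf (α := G.monadic.N) (MonadicN.hole x ⟨C, p⟩) x.names)
        (leaf 0)

variable {ρ : G.R} {a : Fin (rk ρ) → G.Shaping} {r : G.monadic.R}
  {e : Fin (rk r) ≃ Fin (rk ρ)} {ts : Fin (rk ρ) → RTree G.R Empty}
  {us : Fin (rk r) → RTree G.monadic.R Empty}

omit [Fintype S] in
theorem map_hom_body_of_subVal_eq {g : G.MonadicN → RTree S ℕ}
    (hg : ∀ j l, (g (MonadicN.hole (shapedLink ρ a j) l)).IsPattern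
      (rk (MonadicN.hole (shapedLink ρ a j) l)))
    (h : ∀ j C (hC : C ∈ ρ.1.link j), G.subVal ρ ts C = plug (fun σ ts => node σ ts) (a j C).1
      fun p => g (MonadicN.hole (shapedLink ρ a j) ⟨⟨C, hC⟩, p⟩)) :
    (body ρ a).map (hom (Sum.elim g generic)) = G.val (node ρ ts) := by
  rw [val_node, body, List.map_map]
  refine List.map_congr_left fun t ht => ?_
  refine (hom_hom _ _ t ?_).trans (hom_congr ?_)
  · intro c hc b hb
    cases b with
    | inr σ => exact generic_isPattern σ
    | inl n =>
      cases c with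
      | inr σ =>
        rw [countNode_inl_shapedSubst_inr] at hb
        exact absurd hb (lt_irrefl 0)
      | inl C =>
        obtain ⟨j, hj⟩ := G.exists_mem_link ⟨t, ht, hc⟩
        rw [shapedSubst_inl ρ a hj] at hb
        obtain ⟨p, rfl⟩ := (ShapedBig.countNode_tree_pos_iff _ _ _).mp hb
        exact hg j _
  · intro c hc
    cases c with
    | inr σ => exact generic_hom _ _
    | inl C =>
      obtain ⟨j, hj⟩ := G.exists_mem_link ⟨t, ht, hc⟩
      rw [shapedSubst_inl ρ a hj, Sum.elim_inl, h j C hj, ShapedBig.tree]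
      refine (hom_plug (con' := fun σ ts => node σ ts) _ (generic_hom_inr _) _ _ ?_).trans ?_
      · intro p b hb
        rw [countNode_generic] at hb
        obtain rfl : _ = b := by
          by_contra hne
          rw [if_neg hne] at hb
          exact lt_irrefl 0 hb
        exact hg j _
      · congr 1
        funext p
        rw [generic_hom, Sum.elim_inl]

/-- Substituting skeletons and then values of holes equals substituting the filled skeletons at
once; by agreement at the links, these are the values in `G`. -/
theorem map_hom_body (he : ∀ i, r.1.link i = (shapedLink ρ a (e i)).names)
    (hus : ∀ i, G.monadic.Derives (r.1.link i) (us i))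
    (h : ∀ i, ValuesAgree (shapedLink ρ a (e i)) (ts (e i)) (us i)) :
    (body ρ a).map (hom (Sum.elim (G.monadic.subVal r us) generic)) =
      G.val (node ρ ts) := by
  classical
  have hmem : ∀ i (l : (shapedLink ρ a (e i)).Holes),
      (MonadicN.hole _ l : G.monadic.N) ∈ r.1.link i := by
    intro i l
    rw [he i]
    exact ShapedBig.hole_mem_names _ l
  refine map_hom_body_of_subVal_eq (g := G.monadic.subVal r us) (fun j l => ?_) fun j C hC => ?_
  · obtain ⟨i, rfl⟩ := e.surjective j
    have := (hus i).val_isPattern.getD_idxOf (hmem i l) (leaf 0)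
    rwa [← G.monadic.subVal_eq us (hmem i l)] at this
  · obtain ⟨i, rfl⟩ := e.surjective j
    rw [G.subVal_eq ts hC]
    refine (h i ⟨C, hC⟩).trans (congrArg _ (funext fun p => ?_))
    refine Eq.trans ?_ (G.monadic.subVal_eq us (hmem i ⟨⟨C, hC⟩, p⟩)).symm
    rw [he i]

theorem val_startRule (hr : IsInitial ρ a r.1)
    (he : ∀ i, r.1.link i = (shapedLink ρ a (e i)).names)
    (hus : ∀ i, G.monadic.Derives (r.1.link i) (us i))
    (h : ∀ i, ValuesAgree (shapedLink ρ a (e i)) (ts (e i)) (us i)) :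
    G.monadic.val (node r us) = G.val (node ρ ts) := by
  rw [← map_hom_body he hus h, val_node, hr.2.2]
  rfl

theorem valuesAgree_innerRule (hr : IsInner ρ a r.1)
    (he : ∀ i, r.1.link i = (shapedLink ρ a (e i)).names)
    (hus : ∀ i, G.monadic.Derives (r.1.link i) (us i))
    (h : ∀ i, ValuesAgree (shapedLink ρ a (e i)) (ts (e i)) (us i)) :
    ValuesAgree (shapedLhs ρ a) (node ρ ts) (node r us) := by
  classical
  rintro ⟨C, hC⟩
  have hd := isDecomposition_bodyAt hr.1 hC
  rw [← map_hom_body he hus h]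
  have h1 : ((body ρ a).map (hom (Sum.elim (G.monadic.subVal r us) generic))).getD
      ((shapedLhs ρ a).1.1.idxOf C) (leaf 0) =
      (bodyAt ρ a C).hom (Sum.elim (G.monadic.subVal r us) generic) := by
    rw [bodyAt]
    exact List.getD_map (body ρ a) (leaf 0) (hom (Sum.elim (G.monadic.subVal r us) generic))
  rw [h1]
  conv_lhs => rw [← hd.plug_eq]
  have hrhs : ∀ p, fillers (bodyAt ρ a C) p ∈ r.1.rhs := by
    intro p
    rw [hr.2.2]
    exact List.mem_map.mpr ⟨⟨⟨C, hC⟩, p⟩, Finset.mem_toList.mpr (Finset.mem_univ _), rfl⟩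
  refine (hom_plug (con' := fun σ ts => node σ ts) _ (generic_hom_inr _) _ _ ?_).trans ?_
  · exact fun p b hb => subVal_isPattern (fun i => (hus i).val_isPattern) (hrhs p) b hb
  · have hval : G.monadic.val (node r us) = (Finset.univ : Finset (shapedLhs ρ a).Holes).toList.map
        fun l => (fillers (bodyAt ρ a l.1.1) l.2).hom
          (Sum.elim (G.monadic.subVal r us) generic) := by
      rw [val_node, hr.2.2]
      exact List.map_map
    -- Relating each name to its evaluated filler allows the entry at the index of a given hole to
    -- be read off by `getD_idxOf`.
    have hall : List.Forall₂ (fun (n : G.MonadicN) t => ∀ l, n = MonadicN.hole (shapedLhs ρ a) l →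
        t = (fillers (bodyAt ρ a l.1.1) l.2).hom (Sum.elim (G.monadic.subVal r us) generic))
        (shapedLhs ρ a).names ((Finset.univ : Finset (shapedLhs ρ a).Holes).toList.map
        fun l => (fillers (bodyAt ρ a l.1.1) l.2).hom
          (Sum.elim (G.monadic.subVal r us) generic)) := by
      rw [ShapedBig.names, List.forall₂_map_left_iff, List.forall₂_map_right_iff,
        List.forall₂_same]
      intro l _ l' hl
      cases hl
      rfl
    rw [hval]
    exact congrArg _ (funext fun p =>
      (hall.getD_idxOf (ShapedBig.hole_mem_names _ ⟨⟨C, hC⟩, p⟩) (leaf 0) _ rfl).symm)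

end Values

end MCFTG

namespace MCFTG

open RTree

/-! ### The two transducers -/

section Equivalence

variable {S : Type u} [Fintype S] [RankedAlphabet S] (G : MCFTG S)

/-- The possible outputs of the transducer from derivation trees to monadic ones. -/
def IsOutput (initial : Prop) (ρ : G.R) (a : Fin (rk ρ) → G.Shaping)
    (z : Σ r : G.monadic.R, Fin (rk r) ≃ Fin (rk ρ)) : Prop :=
  (initial → IsInitial ρ a z.1.1) ∧ (¬ initial → IsInner ρ a z.1.1) ∧
    ∀ i, z.1.1.link i = (shapedLink ρ a (z.2 i)).names

open scoped Classical in
/-- The transducer from derivation trees to monadic derivation trees. -/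
noncomputable def toMonadic : LDTR G.R G.monadic.R :=
  -- State `true` occurs only at the root, where an initial rule must be output; `false` asks for
  -- inner rules. The automaton computes the annotations.
  LDTR.relabeling (X := G.Shaping) (Q := ULift Bool) (fun ρ a => shapingOf ρ a) ⟨true⟩ ⟨false⟩
    fun q ρ a => if h : ∃ z, G.IsOutput (q.down = true) ρ a z then some h.choose else none

/-- The possible outputs of the transducer from monadic derivation trees. -/
def IsInverseOutput (r : G.monadic.R) (z : Σ ρ : G.R, Fin (rk ρ) ≃ Fin (rk r)) : Prop :=
  ∃ a, (IsInner z.1 a r.1 ∨ IsInitial z.1 a r.1) ∧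
    ∀ i, r.1.link i = (shapedLink z.1 a (z.2.symm i)).names

open scoped Classical in
/-- The transducer from monadic derivation trees to derivation trees. -/
noncomputable def ofMonadic : LDTR G.monadic.R G.R :=
  -- A trivial automaton suffices, since an original rule can be chosen from the monadic rule alone.
  LDTR.relabeling (X := PUnit) (Q := PUnit) (fun _ _ => ⟨⟩) ⟨⟩ ⟨⟩
    fun _ r _ => if h : ∃ z, G.IsInverseOutput r z then some h.choose else none

variable {G}

theorem toMonadic_translates {q : ULift Bool} {ρ : G.R} {ts : Fin (rk ρ) → RTree G.R Empty}
    (h : ∃ z, G.IsOutput (q.down = true) ρ (fun i => eval (fun ρ a => shapingOf ρ a) (ts i)) z) :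
    ∃ z, G.IsOutput (q.down = true) ρ (fun i => eval (fun ρ a => shapingOf ρ a) (ts i)) z ∧
      ∀ us : Fin (rk z.1) → RTree G.monadic.R Empty,
        (∀ i, G.toMonadic.Translates (⟨false⟩ : ULift Bool) (ts (z.2 i)) (us i)) →
        G.toMonadic.Translates q (node ρ ts) (node z.1 us) :=
  ⟨h.choose, h.choose_spec, fun _ hus => LDTR.relabeling_translates (dif_pos h) hus⟩

theorem ofMonadic_translates (r : G.monadic.R) :
    ∃ z, G.IsInverseOutput r z ∧ ∀ (us : Fin (rk r) → RTree G.monadic.R Empty)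
      (ts : Fin (rk z.1) → RTree G.R Empty),
        (∀ i, G.ofMonadic.Translates PUnit.unit (us (z.2 i)) (ts i)) →
        G.ofMonadic.Translates PUnit.unit (node r us) (node z.1 ts) := by
  have h : ∃ z, G.IsInverseOutput r z := by
    obtain ⟨ρ, a, hr⟩ := mem_monadic_rules.mp r.2
    have hl : r.1.links = monadicLinks ρ a := by
      rcases hr with ⟨-, -, hr⟩ | ⟨-, -, hr⟩ <;> rw [hr] <;> rfl
    obtain ⟨e, he⟩ := exists_linkEquiv hl
    exact ⟨⟨ρ, e.symm⟩, a, hr, he⟩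
  exact ⟨h.choose, h.choose_spec, fun _ _ hts => LDTR.relabeling_translates (dif_pos h) hts⟩

theorem exists_isOutput {initial : Prop} {ρ : G.R} {a : Fin (rk ρ) → G.Shaping}
    (h : IsValid ρ a) (h1 : initial → ρ.1.lhs = [G.start])
    (h2 : ¬ initial → ∃ τ ∈ G.rules, ρ.1.lhs ∈ τ.links) : ∃ z, G.IsOutput initial ρ a z := by
  by_cases hi : initial
  · have hr : IsInitial ρ a (startRule ρ a) := ⟨h, h1 hi, rfl⟩
    obtain ⟨e, he⟩ := exists_linkEquiv (r := startRule ρ a) (ρ := ρ) (a := a) rfl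
    exact ⟨⟨⟨_, mem_monadic_rules.mpr ⟨ρ, a, Or.inr hr⟩⟩, e⟩, fun _ => hr, fun h => absurd hi h, he⟩
  · have hr : IsInner ρ a (innerRule ρ a) := ⟨h, h2 hi, rfl⟩
    obtain ⟨e, he⟩ := exists_linkEquiv (r := innerRule ρ a) (ρ := ρ) (a := a) rfl
    exact ⟨⟨⟨_, mem_monadic_rules.mpr ⟨ρ, a, Or.inl hr⟩⟩, e⟩, fun h => absurd h hi, fun _ => hr, he⟩

/-- Properness is part of the induction: an output rule requires valid skeletons at the links, which
the children supply. -/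
theorem exists_toMonadic (d : RTree G.R Empty) (x : G.ShapedBig)
    (hx : x.2 = eval (fun ρ a => shapingOf ρ a) d) (hd : G.Derives x.1.1 d)
    (hused : ∃ τ ∈ G.rules, x.1.1 ∈ τ.links) :
    x.Proper ∧ ∃ d', G.toMonadic.Translates (⟨false⟩ : ULift Bool) d d' ∧
      G.monadic.Derives x.names d' ∧ ValuesAgree x d d' := by
  induction d generalizing x with
  | leaf e => exact e.elim
  | node ρ ts ih =>
    obtain ⟨hlhs, hts⟩ := derives_node_iff.mp hd
    obtain rfl : x = shapedLhs ρ (fun i => eval (fun ρ a => shapingOf ρ a) (ts i)) :=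
      Prod.ext (Subtype.ext hlhs.symm) hx
    have ih' := fun i => ih i (shapedLink ρ (fun i => eval (fun ρ a => shapingOf ρ a) (ts i)) i) rfl
      (hts i) ⟨ρ.1, ρ.2, ρ.1.link_mem i⟩
    choose hp ds hds using ih'
    obtain ⟨⟨r, e⟩, ⟨-, h2, h3⟩, h4⟩ := toMonadic_translates (q := ⟨false⟩)
      (exists_isOutput hp (fun h => absurd h Bool.false_ne_true) fun _ => hused)
    have hr := h2 Bool.false_ne_true
    have hder : ∀ i, G.monadic.Derives (r.1.link i) (ds (e i)) := fun i => by
      rw [h3 i]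
      exact (hds (e i)).2.1
    refine ⟨shapedLhs_proper hp, node r fun i => ds (e i), h4 _ fun i => (hds (e i)).1,
      derives_node_iff.mpr ⟨by rw [hr.2.2]; rfl, hder⟩, ?_⟩
    exact valuesAgree_innerRule (e := e) hr h3 hder fun i => (hds (e i)).2.2

theorem exists_toMonadic_realizes {d : RTree G.R Empty} (hd : d ∈ G.der.language) :
    ∃ d', G.toMonadic.Realizes d d' ∧ d' ∈ G.monadic.der.language ∧
      G.monadic.val d' = G.val d := by
  cases d with
  | leaf e => exact e.elim
  | node ρ ts =>
    obtain ⟨hlhs, hts⟩ := derives_node_iff.mp (G.mem_language_iff.mp hd)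
    have h := fun i => exists_toMonadic (ts i)
      (shapedLink ρ (fun i => eval (fun ρ a => shapingOf ρ a) (ts i)) i) rfl
      (hts i) ⟨ρ.1, ρ.2, ρ.1.link_mem i⟩
    choose hp ds hds using h
    obtain ⟨⟨r, e⟩, ⟨h1, -, h3⟩, h4⟩ := toMonadic_translates (q := ⟨true⟩)
      (exists_isOutput hp (fun _ => hlhs) fun h => absurd rfl h)
    have hr := h1 rfl
    have hder : ∀ i, G.monadic.Derives (r.1.link i) (ds (e i)) := fun i => by
      rw [h3 i]
      exact (hds (e i)).2.1
    exact ⟨node r fun i => ds (e i), h4 _ fun i => (hds (e i)).1,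
      G.monadic.mem_language_iff.mpr (derives_node_iff.mpr ⟨by rw [hr.2.2]; rfl, hder⟩),
      val_startRule (e := e) hr h3 hder fun i => (hds (e i)).2.2⟩

/-- Different annotated rules may give the same monadic rule. Any choice works, because
`names_injective` recovers `x` from the left-hand side and value agreement holds for each choice. -/
theorem exists_ofMonadic (d' : RTree G.monadic.R Empty) (x : G.ShapedBig)
    (hd : G.monadic.Derives x.names d') :
    ∃ d, G.ofMonadic.Translates PUnit.unit d' d ∧ G.Derives x.1.1 d ∧ ValuesAgree x d d' := by
  induction d' generalizing x with
  | leaf e => exact e.elim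
  | node r us ih =>
    obtain ⟨hlhs, hus⟩ := derives_node_iff.mp hd
    obtain ⟨⟨ρ, e⟩, ⟨a, hr, he⟩, h⟩ := ofMonadic_translates r
    simp only at he hr h
    have hr : IsInner ρ a r.1 := by
      refine hr.resolve_right fun hr => x.start_notMem_names ?_
      rw [← hlhs, hr.2.2]
      exact List.mem_singleton.mpr rfl
    obtain rfl : shapedLhs ρ a = x := by
      rw [hr.2.2] at hlhs
      exact ShapedBig.names_injective hlhs
    have ih' := fun j => ih (e j) (shapedLink ρ a j) (by
      have := hus (e j)
      rw [he, e.symm_apply_apply] at this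
      exact this)
    choose ts hts using ih'
    refine ⟨node ρ ts, h us ts fun j => (hts j).1, derives_node_iff.mpr
      ⟨rfl, fun j => (hts j).2.1⟩, valuesAgree_innerRule (e := e.symm) hr he hus fun i => ?_⟩
    have := (hts (e.symm i)).2.2
    rwa [e.apply_symm_apply] at this

theorem exists_ofMonadic_realizes {d' : RTree G.monadic.R Empty}
    (hd : d' ∈ G.monadic.der.language) :
    ∃ d, G.ofMonadic.Realizes d' d ∧ d ∈ G.der.language ∧ G.val d = G.monadic.val d' := by
  cases d' with
  | leaf e => exact e.elim
  | node r us =>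
    obtain ⟨hlhs, hus⟩ := derives_node_iff.mp (G.monadic.mem_language_iff.mp hd)
    obtain ⟨⟨ρ, e⟩, ⟨a, hr, he⟩, h⟩ := ofMonadic_translates r
    simp only at he hr h
    have hr : IsInitial ρ a r.1 := by
      refine hr.resolve_left fun hr => (shapedLhs ρ a).start_notMem_names ?_
      rw [hr.2.2] at hlhs
      exact (show (shapedLhs ρ a).names = [MonadicN.start] from hlhs) ▸ List.mem_singleton.mpr rfl
    have h' := fun j => exists_ofMonadic (us (e j)) (shapedLink ρ a j) (by
      have := hus (e j)
      rw [he, e.symm_apply_apply] at this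
      exact this)
    choose ts hts using h'
    refine ⟨node ρ ts, h us ts fun j => (hts j).1, G.mem_language_iff.mpr (derives_node_iff.mpr
      ⟨hr.2.1, fun j => (hts j).2.1⟩), (val_startRule (e := e.symm) hr he hus fun i => ?_).symm⟩
    have := (hts (e.symm i)).2.2
    rwa [e.apply_symm_apply] at this

variable (G) in
theorem ldtrEquivalent_monadic : G.LDTREquivalent G.monadic :=
  ⟨⟨G.toMonadic, fun _ => exists_toMonadic_realizes⟩,
    ⟨G.ofMonadic, fun _ => exists_ofMonadic_realizes⟩⟩

end Equivalence

end MCFTG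

theorem mainTheorem7 {S : Type u} [Fintype S] [RankedAlphabet S] (G : MCFTG S)
    (hG : 2 ≤ G.width) :
    ∃ G' : MCFTG S,
      G'.IsStartSeparated ∧
      G'.IsMonadic ∧
      G.LDTREquivalent G' ∧
      G'.multiplicity ≤
        G.multiplicity * Fintype.card S * maxRank S ^ 2 * (2 * G.width - 1) ∧
      (G.IsStartSeparated →
        ∀ Δ : Set S, (∀ δ ∈ Δ, RankedAlphabet.rk δ = 0) →
          G.IsLexicalized Δ → G'.IsLexicalized Δ) :=
  ⟨G.monadic, MCFTG.monadic_isStartSeparated, MCFTG.monadic_isMonadic,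
    G.ldtrEquivalent_monadic, MCFTG.monadic_multiplicity_le hG,
    fun hs _ hΔ h => MCFTG.monadic_isLexicalized hs hΔ h⟩
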